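/- All groupoids are locally compact and Hausdorff. Let $G$ be an étale groupoid, i.e. its range and source maps $r,s:G\to G^{(0)}$ are local homeomorphisms. Let $E$ be a twist over $G$: a central extension of topological groupoids $G^{(0)}\times\mathbb T\xrightarrow{\iota}E\xrightarrow{\pi}G$, where $\iota,\pi$ are continuous groupoid homomorphisms, $\iota$ is a homeomorphism onto its range, $\pi$ is an open surjection with kernel $\iota(G^{(0)}\times\mathbb T)$ that induces a homeomorphism $E^{(0)}\cong G^{(0)}$, $\iota(\pi(r(e)),1)=r(e)$ and $\iota(\pi(r(e)),z)\,e=e\,\iota(\pi(s(e)),z)$ for $e\in E$, $z\in\mathbb T$. Put $z\cdot e=\iota(\pi(r(e)),z)\,e$. Let $C_0(G;E)$ (resp. $C_c(G;E)$) be the space of functions $f\in C_0(E)$ (resp. $C_c(E)$) with $f(z\cdot e)=zf(e)$ for all $z\in\mathbb T$, $e\in E$. For $u\in G^{(0)}$ let $G_u=s^{-1}(u)$ and $E_u=\pi^{-1}(G_u)$, and let $\ell^2(G_u;E_u)$ be the Hilbert space of functions $\xi:E_u\to\mathbb C$ with $\xi(z\cdot e)=z\xi(e)$ and $\|\xi\|^2=\sum_{\pi(e)\in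 G_u}|\xi(e)|^2<\infty$. The algebra $C_c(G;E)$ acts on it by $\theta_u(f)\xi=f*\xi$, $(f*\xi)(e')=\sum_{\{\pi(e)\in G:\,r(e)=r(e')\}}f(e)\,\xi(e^{-1}e')$. The reduced twisted groupoid $C^*$-algebra $C^*_r(G;E)$ is the completion of $C_c(G;E)$ in the norm $\|f\|_r=\sup_{u\in G^{(0)}}\|\theta_u(f)\|$, and $j_G:C^*_r(G;E)\to C_0(G;E)$ is the continuous linear extension of the inclusion $C_c(G;E)\subset C_0(G;E)$. Let $S$ be an open subgroupoid of $G$ and let $E_S=\pi^{-1}(S)$, which is a twist over $S$ by restriction. Let $i:C^*_r(S;E_S)\to C^*_r(G;E)$ be the continuous linear extension of the extension-by-zero map $C_c(S;E_S)\to C_c(G;E)$. Write $\operatorname{supp}^\circ(f)=\{e: f(e)\neq 0\}$ for the open support. Proposition. One has $$ i\bigl(C^*_r(S;E_S)\bigr)\subset\bigl\{b\in C^*_r(G;E):\operatorname{supp}^\circ(j_G(b))\subset E_S\bigr\}. $$ If $S$ is not only open but also closed in $G$, then the two sets are equal. -/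

import Mathlib

open scoped CompactlySupported ZeroAtInfty ENNReal

noncomputable section

namespace TwistedGroupoid

/-! ## Topological groupoids -/

/-- A topological groupoid, presented by its space `G` of arrows. The units are the arrows `u`
with `rng u = u`; `rng` and `src` are the range and source maps, regarded as maps from `G` to the
set of units inside `G`. The product `mul a b` is meaningful only if `src a = rng b`: no law
mentions it (and continuity is not required) for other pairs. -/
class TopGroupoid (G : Type*) [TopologicalSpace G] where
  rng : G → G
  src : G → G
  mul : G → G → G
  inv : G → G
  rng_rng : ∀ a, rng (rng a) = rng a
  src_rng : ∀ a, src (rng a) = rng a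
  rng_src : ∀ a, rng (src a) = src a
  src_src : ∀ a, src (src a) = src a
  rng_mul : ∀ a b, src a = rng b → rng (mul a b) = rng a
  src_mul : ∀ a b, src a = rng b → src (mul a b) = src b
  mul_assoc : ∀ a b c, src a = rng b → src b = rng c → mul (mul a b) c = mul a (mul b c)
  rng_mul_self : ∀ a, mul (rng a) a = a
  mul_src_self : ∀ a, mul a (src a) = a
  rng_inv : ∀ a, rng (inv a) = src a
  src_inv : ∀ a, src (inv a) = rng a
  mul_inv_self : ∀ a, mul a (inv a) = rng a
  inv_mul_self : ∀ a, mul (inv a) a = src a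
  continuous_inv : Continuous inv
  continuousOn_mul : ContinuousOn (fun p : G × G => mul p.1 p.2) {p | src p.1 = rng p.2}

open TopGroupoid

/-- The unit space of a groupoid, as a subset (hence a topological subspace) of it. -/
def units (G : Type*) [TopologicalSpace G] [TopGroupoid G] : Set G := {u | rng u = u}

section Basic

variable {G : Type*} [TopologicalSpace G] [TopGroupoid G]

theorem rng_mem_units (a : G) : rng a ∈ units G := rng_rng a

theorem src_mem_units (a : G) : src a ∈ units G := rng_src a

theorem rng_of_unit {u : G} (h : u ∈ units G) : rng u = u := h

theorem src_of_unit {u : G} (h : u ∈ units G) : src u = u := by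
  have h' : rng u = u := h
  rw [← h', src_rng]

theorem inv_mul_cancel_left {a b : G} (h : src a = rng b) : mul (inv a) (mul a b) = b := by
  rw [← mul_assoc _ _ _ (src_inv a) h, inv_mul_self, h, rng_mul_self]

theorem mul_inv_cancel_left {a b : G} (h : rng a = rng b) : mul a (mul (inv a) b) = b := by
  rw [← mul_assoc _ _ _ (rng_inv a).symm ((src_inv a).trans h), mul_inv_self, h, rng_mul_self]

theorem mul_inv_cancel_right {a b : G} (h : src a = rng b) : mul (mul a b) (inv b) = a := by
  rw [mul_assoc _ _ _ h (rng_inv b).symm, mul_inv_self, ← h, mul_src_self]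

theorem inv_mul_cancel_right {a b : G} (h : src a = src b) : mul (mul a (inv b)) b = a := by
  rw [mul_assoc _ _ _ (h.trans (rng_inv b).symm) (src_inv b), inv_mul_self, ← h, mul_src_self]

theorem mul_right_cancel {a b c : G} (ha : src a = rng c) (hb : src b = rng c)
    (h : mul a c = mul b c) : a = b := by
  rw [← mul_inv_cancel_right ha, h, mul_inv_cancel_right hb]

theorem mul_left_cancel {a b c : G} (ha : src c = rng a) (hb : src c = rng b)
    (h : mul c a = mul c b) : a = b := by
  rw [← inv_mul_cancel_left ha, h, inv_mul_cancel_left hb]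

theorem inv_inv (a : G) : inv (inv a) = a := by
  apply mul_right_cancel (c := inv a)
  · rw [src_inv]
  · rw [rng_inv]
  · rw [inv_mul_self, mul_inv_self, src_inv]

theorem inv_mul_rev {a b : G} (h : src a = rng b) : inv (mul a b) = mul (inv b) (inv a) := by
  have h1 : src (inv b) = rng (inv a) := by rw [src_inv, rng_inv, h]
  apply mul_right_cancel (c := mul a b)
  · rw [src_inv]
  · rw [src_mul _ _ h1, src_inv, rng_mul _ _ h]
  · rw [inv_mul_self, src_mul _ _ h, mul_assoc _ _ _ h1 (by rw [src_inv, rng_mul _ _ h]),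
      inv_mul_cancel_left h, inv_mul_self]

theorem continuous_rng : Continuous (rng : G → G) := by
  have h : (rng : G → G) = (fun p : G × G => mul p.1 p.2) ∘ fun a => (a, inv a) := by
    funext a; exact (mul_inv_self a).symm
  rw [h]
  exact continuousOn_mul.comp_continuous (continuous_id.prodMk continuous_inv)
    fun a => (rng_inv a).symm

end Basic

/-- The range map as a map onto the unit space. -/
def rngMap (G : Type*) [TopologicalSpace G] [TopGroupoid G] (a : G) : units G :=
  ⟨rng a, rng_mem_units a⟩

/-- The source map as a map onto the unit space. -/
def srcMap (G : Type*) [TopologicalSpace G] [TopGroupoid G] (a : G) : units G :=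
  ⟨src a, src_mem_units a⟩

/-- A groupoid is étale if its range and source maps are local homeomorphisms onto the unit
space. -/
class IsEtale (G : Type*) [TopologicalSpace G] [TopGroupoid G] : Prop where
  rng_localHomeo : IsLocalHomeomorph (rngMap G)
  src_localHomeo : IsLocalHomeomorph (srcMap G)

/-- A map of groupoids is a homomorphism if it preserves composability and products. -/
def IsGroupoidHom {G H : Type*} [TopologicalSpace G] [TopGroupoid G] [TopologicalSpace H]
    [TopGroupoid H] (f : G → H) : Prop :=
  ∀ a b, src a = rng b → src (f a) = rng (f b) ∧ f (mul a b) = mul (f a) (f b)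

namespace IsGroupoidHom

variable {G H : Type*} [TopologicalSpace G] [TopGroupoid G] [TopologicalSpace H]
  [TopGroupoid H] {f : G → H}

theorem map_mul (hf : IsGroupoidHom f) {a b : G} (h : src a = rng b) :
    f (mul a b) = mul (f a) (f b) := (hf a b h).2

theorem map_rng (hf : IsGroupoidHom f) (a : G) : f (rng a) = rng (f a) := by
  have h1 := hf (rng a) (rng a) (by rw [src_rng, rng_rng])
  have h2 := hf (rng a) a (src_rng a)
  have h3 := h1.2
  rw [show mul (rng a) (rng a) = rng a by
    have := rng_mul_self (rng a); rwa [rng_rng] at this] at h3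
  have h4 := inv_mul_cancel_left h1.1
  rw [← h3, inv_mul_self] at h4
  rw [← h4, h2.1]

theorem map_src (hf : IsGroupoidHom f) (a : G) : f (src a) = src (f a) := by
  have h := (hf a (src a) (rng_src a).symm).1
  rw [h, ← hf.map_rng, rng_src]

theorem map_inv (hf : IsGroupoidHom f) (a : G) : f (inv a) = inv (f a) := by
  have h1 := hf (inv a) a (src_inv a)
  apply mul_right_cancel (c := f a) h1.1 (src_inv _)
  rw [← h1.2, inv_mul_self, inv_mul_self, hf.map_src]

theorem map_units (hf : IsGroupoidHom f) {u : G} (hu : u ∈ units G) : f u ∈ units H := by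
  have : rng u = u := hu
  rw [← this, hf.map_rng]
  exact rng_mem_units _

/-- The map that a homomorphism induces between the unit spaces. -/
def unitsMap (hf : IsGroupoidHom f) (u : units G) : units H := ⟨f u, hf.map_units u.2⟩

end IsGroupoidHom

/-- The trivial bundle of groups `X × 𝕋` over the unit space `X` of `G`. -/
instance trivialBundle (G : Type*) [TopologicalSpace G] [TopGroupoid G] :
    TopGroupoid (units G × Circle) where
  rng p := (p.1, 1)
  src p := (p.1, 1)
  mul p q := (p.1, p.2 * q.2)
  inv p := (p.1, p.2⁻¹)
  rng_rng _ := rfl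
  src_rng _ := rfl
  rng_src _ := rfl
  src_src _ := rfl
  rng_mul _ _ _ := rfl
  src_mul _ _ h := by simpa using h
  mul_assoc a b c _ _ := by simp [_root_.mul_assoc]
  rng_mul_self a := by simp
  mul_src_self a := by simp
  rng_inv _ := rfl
  src_inv _ := rfl
  mul_inv_self a := by simp
  inv_mul_self a := by simp
  continuous_inv := by fun_prop
  continuousOn_mul := by fun_prop

/-! ## Open subgroupoids -/

/-- An open subgroupoid: an open subset closed under products of composable elements and under
inverses. -/
structure OpenSubgroupoid (G : Type*) [TopologicalSpace G] [TopGroupoid G] where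
  carrier : Set G
  isOpen : IsOpen carrier
  mul_mem : ∀ {a b : G}, a ∈ carrier → b ∈ carrier → src a = rng b → mul a b ∈ carrier
  inv_mem : ∀ {a : G}, a ∈ carrier → inv a ∈ carrier

namespace OpenSubgroupoid

variable {G : Type*} [TopologicalSpace G] [TopGroupoid G] (S : OpenSubgroupoid G)

theorem rng_mem {a : G} (h : a ∈ S.carrier) : rng a ∈ S.carrier := by
  rw [← mul_inv_self]; exact S.mul_mem h (S.inv_mem h) (rng_inv a).symm

theorem src_mem {a : G} (h : a ∈ S.carrier) : src a ∈ S.carrier := by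
  rw [← inv_mul_self]; exact S.mul_mem (S.inv_mem h) h (src_inv a)

open Classical in
/-- An open subgroupoid is a topological groupoid under the restricted operations and the
subspace topology. -/
instance : TopGroupoid S.carrier where
  rng a := ⟨rng a.1, S.rng_mem a.2⟩
  src a := ⟨src a.1, S.src_mem a.2⟩
  mul a b := if h : src a.1 = rng b.1 then ⟨mul a.1 b.1, S.mul_mem a.2 b.2 h⟩ else a
  inv a := ⟨inv a.1, S.inv_mem a.2⟩
  rng_rng a := Subtype.ext (rng_rng a.1)
  src_rng a := Subtype.ext (src_rng a.1)
  rng_src a := Subtype.ext (rng_src a.1)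
  src_src a := Subtype.ext (src_src a.1)
  rng_mul a b h := by
    have h' : src a.1 = rng b.1 := congrArg Subtype.val h
    rw [dif_pos h']; exact Subtype.ext (TopGroupoid.rng_mul _ _ h')
  src_mul a b h := by
    have h' : src a.1 = rng b.1 := congrArg Subtype.val h
    rw [dif_pos h']; exact Subtype.ext (TopGroupoid.src_mul _ _ h')
  mul_assoc a b c h k := by
    have h' : src a.1 = rng b.1 := congrArg Subtype.val h
    have k' : src b.1 = rng c.1 := congrArg Subtype.val k
    have h2 : src (mul a.1 b.1) = rng c.1 := (TopGroupoid.src_mul _ _ h').trans k'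
    have h3 : src a.1 = rng (mul b.1 c.1) := h'.trans (TopGroupoid.rng_mul _ _ k').symm
    apply Subtype.ext
    simp only [dif_pos h', dif_pos k', dif_pos h2, dif_pos h3]
    exact TopGroupoid.mul_assoc _ _ _ h' k'
  rng_mul_self a := by
    rw [dif_pos (TopGroupoid.src_rng a.1)]; exact Subtype.ext (TopGroupoid.rng_mul_self _)
  mul_src_self a := by
    rw [dif_pos (TopGroupoid.rng_src a.1).symm]; exact Subtype.ext (TopGroupoid.mul_src_self _)
  rng_inv a := Subtype.ext (TopGroupoid.rng_inv _)
  src_inv a := Subtype.ext (TopGroupoid.src_inv _)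
  mul_inv_self a := by
    rw [dif_pos (TopGroupoid.rng_inv a.1).symm]; exact Subtype.ext (TopGroupoid.mul_inv_self _)
  inv_mul_self a := by
    rw [dif_pos (TopGroupoid.src_inv a.1)]; exact Subtype.ext (TopGroupoid.inv_mul_self _)
  continuous_inv := by
    exact (TopGroupoid.continuous_inv.comp continuous_subtype_val).subtype_mk _
  continuousOn_mul := by
    rw [Topology.IsInducing.subtypeVal.continuousOn_iff]
    have hc : ContinuousOn (fun p : S.carrier × S.carrier => mul p.1.1 p.2.1)
        {p | src p.1.1 = rng p.2.1} := by
      refine (TopGroupoid.continuousOn_mul (G := G)).comp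
        (f := fun p : S.carrier × S.carrier => (p.1.1, p.2.1)) ?_ fun p hp => hp
      fun_prop
    have hs : {p : S.carrier × S.carrier | (⟨src p.1.1, S.src_mem p.1.2⟩ : S.carrier)
        = ⟨rng p.2.1, S.rng_mem p.2.2⟩} = {p | src p.1.1 = rng p.2.1} := by
      ext p; simp
    rw [hs]
    refine hc.congr fun p hp => ?_
    have hp' : src p.1.1 = rng p.2.1 := hp
    simp [hp']

@[simp] theorem coe_rng (a : S.carrier) : ((rng a : S.carrier) : G) = rng a.1 := rfl
@[simp] theorem coe_src (a : S.carrier) : ((src a : S.carrier) : G) = src a.1 := rfl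
@[simp] theorem coe_inv (a : S.carrier) : ((inv a : S.carrier) : G) = inv a.1 := rfl

theorem coe_mul {a b : S.carrier} (h : src a.1 = rng b.1) :
    ((mul a b : S.carrier) : G) = mul a.1 b.1 := by
  classical
  change ((if h : src a.1 = rng b.1 then
    (⟨mul a.1 b.1, S.mul_mem a.2 b.2 h⟩ : S.carrier) else a : S.carrier) : G) = _
  rw [dif_pos h]

theorem mem_units_iff (a : S.carrier) : a ∈ units S.carrier ↔ a.1 ∈ units G := by
  change (rng a = a) ↔ rng a.1 = a.1
  rw [Subtype.ext_iff]; rfl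

/-- The inclusion of the unit space of an open subgroupoid. -/
def unitsIncl (u : units S.carrier) : units G := ⟨u.1.1, (S.mem_units_iff u.1).1 u.2⟩

theorem continuous_unitsIncl : Continuous S.unitsIncl :=
  (continuous_subtype_val.comp continuous_subtype_val).subtype_mk _

theorem isEmbedding_unitsIncl : Topology.IsEmbedding S.unitsIncl := by
  have h : Topology.IsEmbedding (fun u : units S.carrier => (u.1.1 : G)) :=
    Topology.IsEmbedding.subtypeVal.comp Topology.IsEmbedding.subtypeVal
  exact Topology.IsEmbedding.of_comp S.continuous_unitsIncl continuous_subtype_val h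

theorem range_unitsIncl : Set.range S.unitsIncl = {u : units G | u.1 ∈ S.carrier} := by
  ext u
  constructor
  · rintro ⟨v, rfl⟩; exact v.1.2
  · intro hu
    exact ⟨⟨⟨u.1, hu⟩, (S.mem_units_iff _).2 u.2⟩, rfl⟩

theorem isOpenEmbedding_unitsIncl : Topology.IsOpenEmbedding S.unitsIncl :=
  ⟨S.isEmbedding_unitsIncl, by
    rw [range_unitsIncl]; exact S.isOpen.preimage continuous_subtype_val⟩

instance [IsEtale G] : IsEtale S.carrier where
  rng_localHomeo := by
    have hc : Continuous (rngMap S.carrier) := continuous_rng.subtype_mk _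
    have h1 : IsLocalHomeomorph (rngMap G ∘ (Subtype.val : S.carrier → G)) :=
      IsEtale.rng_localHomeo.comp S.isOpen.isOpenEmbedding_subtypeVal.isLocalHomeomorph
    exact IsLocalHomeomorph.of_comp (g := S.unitsIncl) (f := rngMap S.carrier) h1
      S.isOpenEmbedding_unitsIncl.isLocalHomeomorph hc
  src_localHomeo := by
    have hs : Continuous (src : S.carrier → S.carrier) := by
      have h : (src : S.carrier → S.carrier) = fun a => rng (inv a) := by
        funext a; exact (rng_inv a).symm
      rw [h]; exact continuous_rng.comp continuous_inv
    have hc : Continuous (srcMap S.carrier) := hs.subtype_mk _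
    have h1 : IsLocalHomeomorph (srcMap G ∘ (Subtype.val : S.carrier → G)) :=
      IsEtale.src_localHomeo.comp S.isOpen.isOpenEmbedding_subtypeVal.isLocalHomeomorph
    exact IsLocalHomeomorph.of_comp (g := S.unitsIncl) (f := srcMap S.carrier) h1
      S.isOpenEmbedding_unitsIncl.isLocalHomeomorph hc

end OpenSubgroupoid

/-! ## Twists -/

/-- A twist over the groupoid `G`: a central groupoid extension `G⁽⁰⁾ × 𝕋 → E → G`. -/
structure Twist (G E : Type*) [TopologicalSpace G] [TopGroupoid G] [TopologicalSpace E]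
    [TopGroupoid E] where
  iota : units G × Circle → E
  pi : E → G
  iota_hom : IsGroupoidHom iota
  /-- `iota` is continuous and a homeomorphism onto its range. -/
  iota_embedding : Topology.IsEmbedding iota
  pi_hom : IsGroupoidHom pi
  pi_continuous : Continuous pi
  pi_open : IsOpenMap pi
  pi_surjective : Function.Surjective pi
  /-- `pi` induces a homeomorphism between the unit spaces. -/
  pi_units : IsHomeomorph pi_hom.unitsMap
  /-- The kernel of `pi` is the range of `iota`. -/
  ker_pi : ∀ e, pi e ∈ units G ↔ e ∈ Set.range iota
  iota_one : ∀ e : E, iota (pi_hom.unitsMap (rngMap E e), 1) = rng e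
  central : ∀ (e : E) (z : Circle), mul (iota (pi_hom.unitsMap (rngMap E e), z)) e =
    mul e (iota (pi_hom.unitsMap (srcMap E e), z))

namespace Twist

variable {G E : Type*} [TopologicalSpace G] [TopGroupoid G] [TopologicalSpace E] [TopGroupoid E]
  (T : Twist G E)

/-- The action `z · e = ι(r(e), z) e` of the circle on the twist. -/
def act (z : Circle) (e : E) : E := mul (T.iota (T.pi_hom.unitsMap (rngMap E e), z)) e

theorem pi_rng (e : E) : T.pi (rng e) = rng (T.pi e) := T.pi_hom.map_rng e
theorem pi_src (e : E) : T.pi (src e) = src (T.pi e) := T.pi_hom.map_src e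

theorem units_inj {u v : E} (hu : u ∈ units E) (hv : v ∈ units E) (h : T.pi u = T.pi v) :
    u = v := by
  have := T.pi_units.bijective.1 (a₁ := ⟨u, hu⟩) (a₂ := ⟨v, hv⟩) (Subtype.ext h)
  exact congrArg Subtype.val this

theorem rng_eq_iff {a b : E} : rng a = rng b ↔ rng (T.pi a) = rng (T.pi b) := by
  constructor
  · intro h; rw [← T.pi_rng, h, T.pi_rng]
  · intro h
    exact T.units_inj (rng_mem_units a) (rng_mem_units b) (by rw [T.pi_rng, T.pi_rng, h])

theorem src_eq_iff {a b : E} : src a = src b ↔ src (T.pi a) = src (T.pi b) := by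
  constructor
  · intro h; rw [← T.pi_src, h, T.pi_src]
  · intro h
    exact T.units_inj (src_mem_units a) (src_mem_units b) (by rw [T.pi_src, T.pi_src, h])

theorem src_eq_rng_iff {a b : E} : src a = rng b ↔ src (T.pi a) = rng (T.pi b) := by
  constructor
  · intro h; rw [← T.pi_src, h, T.pi_rng]
  · intro h
    exact T.units_inj (src_mem_units a) (rng_mem_units b) (by rw [T.pi_src, T.pi_rng, h])

theorem iota_one_unit (u : units G) : ∃ x ∈ units E, T.pi x = u ∧ T.iota (u, 1) = x := by
  obtain ⟨⟨x, hx⟩, rfl⟩ := T.pi_units.bijective.2 u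
  refine ⟨x, hx, rfl, ?_⟩
  have h := T.iota_one x
  have hr : rngMap E x = ⟨x, hx⟩ := Subtype.ext hx
  rw [hr] at h
  rw [h]; exact hx

theorem rng_iota (u : units G) (z : Circle) : rng (T.iota (u, z)) = T.iota (u, 1) :=
  (T.iota_hom.map_rng (u, z)).symm

theorem src_iota (u : units G) (z : Circle) : src (T.iota (u, z)) = T.iota (u, 1) :=
  (T.iota_hom.map_src (u, z)).symm

theorem iota_mul (u : units G) (z w : Circle) :
    T.iota (u, z * w) = mul (T.iota (u, z)) (T.iota (u, w)) :=
  T.iota_hom.map_mul (a := (u, z)) (b := (u, w)) rfl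

theorem pi_iota (u : units G) (z : Circle) : T.pi (T.iota (u, z)) = u := by
  have h1 : T.pi (T.iota (u, z)) ∈ units G := (T.ker_pi _).2 ⟨_, rfl⟩
  obtain ⟨x, -, hx, hx'⟩ := T.iota_one_unit u
  rw [← rng_of_unit h1, ← T.pi_rng, T.rng_iota, hx', hx]

theorem src_iota_rng (e : E) (z : Circle) :
    src (T.iota (T.pi_hom.unitsMap (rngMap E e), z)) = rng e := by
  rw [T.src_iota, T.iota_one]

theorem rng_act (z : Circle) (e : E) : rng (T.act z e) = rng e := by
  rw [act, rng_mul _ _ (T.src_iota_rng e z), T.rng_iota, T.iota_one]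

theorem src_act (z : Circle) (e : E) : src (T.act z e) = src e := by
  rw [act, src_mul _ _ (T.src_iota_rng e z)]

theorem pi_act (z : Circle) (e : E) : T.pi (T.act z e) = T.pi e := by
  rw [act, T.pi_hom.map_mul (T.src_iota_rng e z), T.pi_iota]
  change mul (T.pi (rng e)) _ = _
  rw [T.pi_rng, rng_mul_self]

theorem act_mul {a b : E} (h : src a = rng b) (z : Circle) :
    T.act z (mul a b) = mul (T.act z a) b := by
  have hr : rngMap E (mul a b) = rngMap E a := Subtype.ext (rng_mul _ _ h)
  rw [act, act, hr, mul_assoc _ _ _ (T.src_iota_rng a z) h]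

theorem mul_act {a b : E} (h : src a = rng b) (z : Circle) :
    mul a (T.act z b) = T.act z (mul a b) := by
  have hs : rngMap E b = srcMap E a := Subtype.ext h.symm
  have h1 : rng (T.iota (T.pi_hom.unitsMap (srcMap E a), z)) = rng b := by
    rw [T.rng_iota, ← hs, T.iota_one]
  have h2 : src (T.iota (T.pi_hom.unitsMap (srcMap E a), z)) = rng b := by
    rw [T.src_iota, ← hs, T.iota_one]
  rw [T.act_mul h, act, act, T.central a, hs, mul_assoc _ _ _ (h.trans h1.symm) h2]

theorem act_act (z w : Circle) (e : E) : T.act z (T.act w e) = T.act (z * w) e := by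
  have hr : rngMap E (T.act w e) = rngMap E e := Subtype.ext (T.rng_act w e)
  rw [act, hr, act, act, T.iota_mul, mul_assoc _ _ _ _ (T.src_iota_rng e w)]
  rw [T.src_iota, T.rng_iota]

theorem one_act (e : E) : T.act 1 e = e := by
  rw [act, T.iota_one, rng_mul_self]

theorem exists_act {a b : E} (h : T.pi a = T.pi b) : ∃ z, b = T.act z a := by
  have hs : src b = src a := T.src_eq_iff.2 (by rw [h])
  have hr : rng b = rng a := T.rng_eq_iff.2 (by rw [h])
  have hc : src b = rng (inv a) := by rw [rng_inv, hs]
  have hk : T.pi (mul b (inv a)) ∈ units G := by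
    rw [T.pi_hom.map_mul hc, T.pi_hom.map_inv, h, mul_inv_self]
    exact rng_mem_units _
  obtain ⟨⟨u, z⟩, hz⟩ := (T.ker_pi _).1 hk
  have hu : T.pi_hom.unitsMap (rngMap E a) = u := by
    apply Subtype.ext
    change T.pi (rng a) = u
    rw [← T.pi_iota u z, hz, T.pi_hom.map_mul hc, T.pi_hom.map_inv, h, mul_inv_self, T.pi_rng, h]
  refine ⟨z, ?_⟩
  rw [act, hu, hz, inv_mul_cancel_right hs]

theorem inv_act (z : Circle) (a : E) : inv (T.act z a) = T.act z⁻¹ (inv a) := by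
  have hinv : src (inv a) = rng (T.act z a) := by rw [src_inv, rng_act]
  apply mul_right_cancel (c := T.act z a)
  · exact src_inv _
  · rw [T.src_act, src_inv, rng_act]
  rw [inv_mul_self, ← T.act_mul hinv, T.mul_act (src_inv a), inv_mul_self, src_act, act_act,
    inv_mul_cancel, one_act]

/-- The preimage `E_S` of an open subgroupoid `S` of `G`, as an open subgroupoid of the twist. -/
def preimage (S : OpenSubgroupoid G) : OpenSubgroupoid E where
  carrier := T.pi ⁻¹' S.carrier
  isOpen := S.isOpen.preimage T.pi_continuous
  mul_mem {a b} ha hb h := by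
    change T.pi (mul a b) ∈ S.carrier
    rw [T.pi_hom.map_mul h]
    exact S.mul_mem ha hb (T.src_eq_rng_iff.1 h)
  inv_mem {a} ha := by
    change T.pi (inv a) ∈ S.carrier
    rw [T.pi_hom.map_inv]
    exact S.inv_mem ha

/-- The restriction of `pi` to `E_S → S`. -/
def restrictPi (S : OpenSubgroupoid G) (e : (T.preimage S).carrier) : S.carrier := ⟨T.pi e.1, e.2⟩

/-- The restriction of `iota` to `S⁽⁰⁾ × 𝕋 → E_S`. -/
def restrictIota (S : OpenSubgroupoid G) (p : units S.carrier × Circle) :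
    (T.preimage S).carrier :=
  ⟨T.iota (S.unitsIncl p.1, p.2), by
    change T.pi _ ∈ S.carrier
    rw [T.pi_iota]; exact p.1.1.2⟩

theorem restrictPi_hom (S : OpenSubgroupoid G) : IsGroupoidHom (T.restrictPi S) := by
  intro a b h
  have h' : src a.1 = rng b.1 := congrArg Subtype.val h
  have h2 := T.pi_hom _ _ h'
  refine ⟨Subtype.ext h2.1, Subtype.ext ?_⟩
  rw [OpenSubgroupoid.coe_mul _ (a := T.restrictPi S a) (b := T.restrictPi S b) h2.1]
  change T.pi ((mul a b : (T.preimage S).carrier) : E) = _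
  rw [OpenSubgroupoid.coe_mul _ h', h2.2]
  rfl

theorem restrictIota_hom (S : OpenSubgroupoid G) : IsGroupoidHom (T.restrictIota S) := by
  intro a b h
  have h0 : (a.1, (1 : Circle)) = (b.1, 1) := h
  have hab : a.1 = b.1 := (Prod.mk.inj h0).1
  have h' : src ((S.unitsIncl a.1, a.2) : units G × Circle) = rng (S.unitsIncl b.1, b.2) := by
    rw [hab]; rfl
  have h2 := T.iota_hom _ _ h'
  refine ⟨Subtype.ext h2.1, Subtype.ext ?_⟩
  rw [OpenSubgroupoid.coe_mul _ (a := T.restrictIota S a) (b := T.restrictIota S b) h2.1]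
  exact h2.2

/-- The restriction `S⁽⁰⁾ × 𝕋 → E_S → S` of a twist to an open subgroupoid. -/
def restrict (S : OpenSubgroupoid G) : Twist S.carrier (T.preimage S).carrier where
  iota := T.restrictIota S
  pi := T.restrictPi S
  iota_hom := T.restrictIota_hom S
  iota_embedding := by
    have h1 : Topology.IsEmbedding (fun p : units S.carrier × Circle =>
        T.iota (S.unitsIncl p.1, p.2)) :=
      T.iota_embedding.comp (S.isEmbedding_unitsIncl.prodMap Topology.IsEmbedding.id)
    exact Topology.IsEmbedding.of_comp (h1.continuous.subtype_mk _) continuous_subtype_val h1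
  pi_hom := T.restrictPi_hom S
  pi_continuous := (T.pi_continuous.comp continuous_subtype_val).subtype_mk _
  pi_open := T.pi_open.restrictPreimage S.carrier
  pi_surjective g := by
    obtain ⟨e, he⟩ := T.pi_surjective g.1
    exact ⟨⟨e, by change T.pi e ∈ S.carrier; rw [he]; exact g.2⟩, Subtype.ext he⟩
  pi_units := by
    have hcont : Continuous (T.restrictPi_hom S).unitsMap :=
      ((((T.pi_continuous.comp continuous_subtype_val).subtype_mk _ :
        Continuous (T.restrictPi S))).comp continuous_subtype_val).subtype_mk _
    have hopen : IsOpenMap (T.restrictPi_hom S).unitsMap := by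
      have h1 : IsOpenMap (S.unitsIncl ∘ (T.restrictPi_hom S).unitsMap) :=
        T.pi_units.isOpenMap.comp (T.preimage S).isOpenEmbedding_unitsIncl.isOpenMap
      intro U hU
      have h2 := (h1 U hU).preimage S.continuous_unitsIncl
      rwa [Set.image_comp, Set.preimage_image_eq _ S.isEmbedding_unitsIncl.injective] at h2
    refine ⟨hcont, hopen, ?_, ?_⟩
    · intro u v h
      have h' : T.pi u.1.1 = T.pi v.1.1 := congrArg (fun x => x.1.1) h
      exact Subtype.ext (Subtype.ext (T.units_inj (((T.preimage S).mem_units_iff _).1 u.2)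
        (((T.preimage S).mem_units_iff _).1 v.2) h'))
    · intro u
      obtain ⟨x, hx, hxu, -⟩ := T.iota_one_unit (S.unitsIncl u)
      refine ⟨⟨⟨x, ?_⟩, ((T.preimage S).mem_units_iff _).2 hx⟩, ?_⟩
      · change T.pi x ∈ S.carrier; rw [hxu]; exact u.1.2
      · exact Subtype.ext (Subtype.ext hxu)
  ker_pi e := by
    rw [S.mem_units_iff]
    change T.pi e.1 ∈ units G ↔ _
    rw [T.ker_pi]
    constructor
    · rintro ⟨⟨u, z⟩, h⟩
      have hu : u.1 ∈ S.carrier := by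
        rw [← T.pi_iota u z, h]; exact e.2
      exact ⟨(⟨⟨u.1, hu⟩, (S.mem_units_iff _).2 u.2⟩, z), Subtype.ext h⟩
    · rintro ⟨⟨u, z⟩, rfl⟩
      exact ⟨(S.unitsIncl u, z), rfl⟩
  iota_one e := Subtype.ext (T.iota_one e.1)
  central e z := by
    apply Subtype.ext
    rw [OpenSubgroupoid.coe_mul, OpenSubgroupoid.coe_mul]
    · exact T.central e.1 z
    · change src e.1 = rng (T.iota (T.pi_hom.unitsMap (srcMap E e.1), z))
      rw [T.rng_iota]
      have : rngMap E (src e.1) = srcMap E e.1 := Subtype.ext (rng_src e.1)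
      rw [← this, T.iota_one, rng_src]
    · exact T.src_iota_rng e.1 z

end Twist

namespace Twist

section Spaces

variable {G E : Type*} [TopologicalSpace G] [TopGroupoid G] [TopologicalSpace E] [TopGroupoid E]
  (T : Twist G E)

/-! ## Function spaces -/

/-- `C_c(G;E)`: continuous compactly supported functions with `f (z · e) = z f(e)`. -/
def Cc : Submodule ℂ C_c(E, ℂ) where
  carrier := {f | ∀ (z : Circle) (e : E), f (T.act z e) = z * f e}
  add_mem' {f g} hf hg z e := by
    simp only [CompactlySupportedContinuousMap.coe_add, Pi.add_apply, hf z e, hg z e]; ring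
  zero_mem' z e := by simp
  smul_mem' c f hf z e := by
    simp only [CompactlySupportedContinuousMap.coe_smul, Pi.smul_apply, hf z e, smul_eq_mul]; ring

/-- The continuous functions on `E` vanishing at infinity with `f (z · e) = z f(e)`. -/
def c0Sub : Submodule ℂ C₀(E, ℂ) where
  carrier := {f | ∀ (z : Circle) (e : E), f (T.act z e) = z * f e}
  add_mem' {f g} hf hg z e := by
    simp only [ZeroAtInftyContinuousMap.coe_add, Pi.add_apply, hf z e, hg z e]; ring
  zero_mem' z e := by simp
  smul_mem' c f hf z e := by
    simp only [ZeroAtInftyContinuousMap.coe_smul, Pi.smul_apply, hf z e, smul_eq_mul]; ring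

/-- `C₀(G;E)`, with the supremum norm. -/
def C0 : Type _ := T.c0Sub

instance : NormedAddCommGroup T.C0 := inferInstanceAs (NormedAddCommGroup T.c0Sub)

instance : NormedSpace ℂ T.C0 := inferInstanceAs (NormedSpace ℂ T.c0Sub)

theorem isClosed_c0Sub : IsClosed (T.c0Sub : Set C₀(E, ℂ)) := by
  have hev : ∀ e : E, Continuous fun f : C₀(E, ℂ) => f e := fun e =>
    (BoundedContinuousFunction.lipschitz_eval_const e).continuous.comp
      ZeroAtInftyContinuousMap.isometry_toBCF.continuous
  have : (T.c0Sub : Set C₀(E, ℂ)) =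
      ⋂ (z : Circle) (e : E), {f : C₀(E, ℂ) | f (T.act z e) = z * f e} := by
    ext f; simp only [Set.mem_iInter]; rfl
  rw [this]
  exact isClosed_iInter fun z => isClosed_iInter fun e =>
    isClosed_eq (hev _) (continuous_const.mul (hev _))

instance : CompleteSpace T.C0 := T.isClosed_c0Sub.completeSpace_coe

/-- The fibre `E_u` of the source map over a unit `u`. -/
abbrev fib (u : units G) : Type _ := {e : E // src (T.pi e) = u.1}

/-- A set-theoretic section of `pi : E → G`. -/
def sec (g : G) : E := Function.surjInv T.pi_surjective g

@[simp] theorem pi_sec (g : G) : T.pi (T.sec g) = g := Function.surjInv_eq _ g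

/-- The section, as a map `G_u → E_u`. -/
def secFib (u : units G) (g : {g : G // src g = u.1}) : T.fib u :=
  ⟨T.sec g.1, by rw [T.pi_sec]; exact g.2⟩

theorem src_sec_inv {g : G} {e : E} (h : rng g = rng (T.pi e)) : src (inv (T.sec g)) = rng e := by
  rw [src_inv, T.rng_eq_iff, T.pi_sec, h]

/-- The circle action on `E_u`. -/
def actFib {u : units G} (z : Circle) (e : T.fib u) : T.fib u :=
  ⟨T.act z e.1, by rw [T.pi_act]; exact e.2⟩

/-- The product `σ(g)⁻¹ e` in `E_u`, for `e` in `E_u` and `g` with `r(g) = r(π(e))`. -/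
def translate {u : units G} (e : T.fib u) (g : {g : G // rng g = rng (T.pi e.1)}) : T.fib u :=
  ⟨mul (inv (T.sec g.1)) e.1, by
    rw [← T.pi_src, src_mul _ _ (T.src_sec_inv g.2), T.pi_src]; exact e.2⟩

/-- The convolution `f * ξ (e) = ∑ f(σ(g)) ξ(σ(g)⁻¹ e)`, the sum running over the `g` in `G` with
`r(g) = r(π(e))`. For `f` in `C_c(G;E)` over an étale groupoid, only finitely many of its terms
are nonzero. -/
def conv {u : units G} (f : E → ℂ) (ξ : T.fib u → ℂ) (e : T.fib u) : ℂ :=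
  ∑' g : {g : G // rng g = rng (T.pi e.1)}, f (T.sec g.1) * ξ (T.translate e g)

/-- The functions `ξ` on `E_u` with `ξ (z · e) = z ξ(e)` such that `∑ |ξ(σ(g))|²`, the sum running
over the `g` in `G_u`, is finite. -/
def l2Sub (u : units G) : Submodule ℂ (T.fib u → ℂ) where
  carrier := {ξ | (∀ (z : Circle) (e : T.fib u), ξ (T.actFib z e) = z * ξ e) ∧
    Summable fun g => ‖ξ (T.secFib u g)‖ ^ 2}
  add_mem' {ξ η} hξ hη := by
    refine ⟨fun z e => by simp only [Pi.add_apply, hξ.1 z e, hη.1 z e]; ring, ?_⟩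
    have h1 : Memℓp (fun g => ξ (T.secFib u g)) 2 := memℓp_gen (by simpa using hξ.2)
    have h2 : Memℓp (fun g => η (T.secFib u g)) 2 := memℓp_gen (by simpa using hη.2)
    simpa using (memℓp_gen_iff (by simp)).1 (h1.add h2)
  zero_mem' := by simp [summable_zero]
  smul_mem' c ξ hξ := by
    refine ⟨fun z e => by simp only [Pi.smul_apply, hξ.1 z e, smul_eq_mul]; ring, ?_⟩
    simp only [Pi.smul_apply, norm_smul, mul_pow]
    exact hξ.2.mul_left _

/-- The Hilbert space `ℓ²(G_u; E_u)`. -/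
def L2 (u : units G) : Type _ := T.l2Sub u

instance (u : units G) : AddCommGroup (T.L2 u) := inferInstanceAs (AddCommGroup (T.l2Sub u))

instance (u : units G) : Module ℂ (T.L2 u) := inferInstanceAs (Module ℂ (T.l2Sub u))

variable {T} in
theorem norm_eq_of_pi_eq {u : units G} {ξ : T.fib u → ℂ}
    (hξ : ∀ (z : Circle) (e : T.fib u), ξ (T.actFib z e) = z * ξ e) {a b : T.fib u}
    (h : T.pi a.1 = T.pi b.1) : ‖ξ a‖ = ‖ξ b‖ := by
  obtain ⟨z, hz⟩ := T.exists_act h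
  have : b = T.actFib z a := Subtype.ext hz
  rw [this, hξ, norm_mul, Circle.norm_coe, one_mul]

variable {T} in
theorem norm_eq_of_pi_eq' {f : E → ℂ}
    (hf : ∀ (z : Circle) (e : E), f (T.act z e) = z * f e) {a b : E}
    (h : T.pi a = T.pi b) : ‖f a‖ = ‖f b‖ := by
  obtain ⟨z, hz⟩ := T.exists_act h
  rw [hz, hf, norm_mul, Circle.norm_coe, one_mul]

/-- Restriction along the section identifies `ℓ²(G_u; E_u)` with a space of square-summable
functions on `G_u`. -/
def L2.toLp (u : units G) : T.L2 u →ₗ[ℂ] lp (fun _ : {g : G // src g = u.1} => ℂ) 2 where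
  toFun ξ := ⟨fun g => ξ.1 (T.secFib u g), memℓp_gen (by simpa using ξ.2.2)⟩
  map_add' _ _ := rfl
  map_smul' _ _ := rfl

theorem L2.toLp_injective (u : units G) : Function.Injective (L2.toLp T u) := by
  intro ξ η h
  rw [← sub_eq_zero] at h ⊢
  rw [← map_sub] at h
  set ζ := ξ - η
  apply Subtype.ext
  funext e
  have h1 : T.pi e.1 = T.pi (T.secFib u ⟨T.pi e.1, e.2⟩).1 := (T.pi_sec _).symm
  have h2 := norm_eq_of_pi_eq ζ.2.1 h1
  have h3 : ζ.1 (T.secFib u ⟨T.pi e.1, e.2⟩) = 0 := congrFun (congrArg Subtype.val h) _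
  rw [h3, norm_zero, norm_eq_zero] at h2
  exact h2

/-- The norm of `ℓ²(G_u; E_u)`, with `‖ξ‖² = ∑ |ξ(σ(g))|²` over the `g` in `G_u`. -/
instance (u : units G) : NormedAddCommGroup (T.L2 u) :=
  NormedAddCommGroup.induced _ _ (L2.toLp T u) (L2.toLp_injective T u)

instance (u : units G) : NormedSpace ℂ (T.L2 u) :=
  NormedSpace.induced ℂ _ _ (L2.toLp T u)

instance (u : units G) : InnerProductSpace ℂ (T.L2 u) where
  inner ξ η := inner ℂ (L2.toLp T u ξ) (L2.toLp T u η)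
  norm_sq_eq_re_inner ξ := norm_sq_eq_re_inner (𝕜 := ℂ) (L2.toLp T u ξ)
  conj_inner_symm ξ η := inner_conj_symm _ _
  add_left ξ η ζ := by rw [map_add, inner_add_left]
  smul_left ξ η c := by rw [map_smul, inner_smul_left]

theorem L2.norm_sq (u : units G) (ξ : T.L2 u) :
    ‖ξ‖ ^ 2 = ∑' g, ‖ξ.1 (T.secFib u g)‖ ^ 2 := by
  have h := lp.norm_rpow_eq_tsum (p := 2) (by simp) (L2.toLp T u ξ)
  simp only [ENNReal.toReal_ofNat, Real.rpow_ofNat] at h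
  exact h

/-- The `ℓ²` square sum, in the extended nonnegative reals. -/
def nsq {u : units G} (ξ : T.fib u → ℂ) : ℝ≥0∞ := ∑' g, ‖ξ (T.secFib u g)‖ₑ ^ 2

theorem nsq_eq {u : units G} (ξ : T.L2 u) : T.nsq ξ.1 = ENNReal.ofReal (‖ξ‖ ^ 2) := by
  rw [L2.norm_sq, ENNReal.ofReal_tsum_of_nonneg (fun _ => by positivity) ξ.2.2, nsq]
  congr 1; funext g
  rw [ENNReal.ofReal_pow (norm_nonneg _), ofReal_norm]

theorem summable_of_nsq {u : units G} {ξ : T.fib u → ℂ} (h : T.nsq ξ ≠ ⊤) :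
    Summable fun g => ‖ξ (T.secFib u g)‖ ^ 2 := by
  have h' : ∑' g, ((‖ξ (T.secFib u g)‖₊ ^ 2 : NNReal) : ℝ≥0∞) ≠ ⊤ := by
    rw [nsq] at h
    convert h using 3
    rw [ENNReal.coe_pow]; rfl
  have := ENNReal.tsum_coe_ne_top_iff_summable_coe.1 h'
  simpa using this

/-! ## The regular representations are bounded -/

theorem norm_le_of_nsq_le {u : units G} {ξ η : T.L2 u} {C : ℝ} (hC : 0 ≤ C)
    (h : T.nsq ξ.1 ≤ ENNReal.ofReal (C ^ 2) * T.nsq η.1) : ‖ξ‖ ≤ C * ‖η‖ := by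
  rw [T.nsq_eq, T.nsq_eq, ← ENNReal.ofReal_mul (by positivity),
    ENNReal.ofReal_le_ofReal_iff (by positivity), ← mul_pow] at h
  exact le_of_sq_le_sq h (by positivity)

variable {T} in
/-- The terms of the convolution depend only on the image in `G` of the summation variable. -/
theorem term_eq {u : units G} {f : E → ℂ} {ξ : T.fib u → ℂ}
    (hf : ∀ (z : Circle) (e : E), f (T.act z e) = z * f e)
    (hξ : ∀ (z : Circle) (e : T.fib u), ξ (T.actFib z e) = z * ξ e)
    {a b e : E} (hab : T.pi a = T.pi b) {ha hb}
    (he : src (inv a) = rng e) :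
    f a * ξ ⟨mul (inv a) e, ha⟩ = f b * ξ ⟨mul (inv b) e, hb⟩ := by
  obtain ⟨z, rfl⟩ := T.exists_act hab
  have h1 : (⟨mul (inv (T.act z a)) e, hb⟩ : T.fib u) = T.actFib z⁻¹ ⟨mul (inv a) e, ha⟩ :=
    by
    apply Subtype.ext
    change mul (inv (T.act z a)) e = T.act z⁻¹ (mul (inv a) e)
    rw [T.inv_act, T.act_mul he]
  rw [h1, hξ, hf, Circle.coe_inv]
  have : (z : ℂ) ≠ 0 := Circle.coe_ne_zero z
  field_simp

theorem conv_equivariant {u : units G} {f : E → ℂ} {ξ : T.fib u → ℂ}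
    (hξ : ∀ (z : Circle) (e : T.fib u), ξ (T.actFib z e) = z * ξ e) (z : Circle) (e : T.fib u) :
    T.conv f ξ (T.actFib z e) = z * T.conv f ξ e := by
  have hp : T.pi (T.actFib z e).1 = T.pi e.1 := T.pi_act z e.1
  let φ : {g : G // rng g = rng (T.pi e.1)} ≃ {g : G // rng g = rng (T.pi (T.actFib z e).1)} :=
    Equiv.subtypeEquivRight fun g => by rw [hp]
  rw [conv, ← φ.tsum_eq, conv, ← tsum_mul_left]
  congr 1; funext g
  have h1 : T.translate (T.actFib z e) (φ g) = T.actFib z (T.translate e g) :=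
    Subtype.ext (T.mul_act (T.src_sec_inv g.2) z)
  rw [h1, hξ]
  change f (T.sec g.1) * _ = _
  ring

theorem exists_encard_le {X Y : Type*} [TopologicalSpace X] {p : X → Y}
    (hp : ∀ x, ∃ U ∈ nhds x, Set.InjOn p U) {K : Set X} (hK : IsCompact K) :
    ∃ n : ℕ, ∀ y, (K ∩ p ⁻¹' {y}).encard ≤ n := by
  refine hK.induction_on (p := fun K => ∃ n : ℕ, ∀ y, (K ∩ p ⁻¹' {y}).encard ≤ n)
    ⟨0, fun y => by simp⟩ ?_ ?_ ?_
  · rintro s t hst ⟨n, hn⟩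
    exact ⟨n, fun y => (Set.encard_le_encard (by gcongr)).trans (hn y)⟩
  · rintro s t ⟨n, hn⟩ ⟨m, hm⟩
    refine ⟨n + m, fun y => ?_⟩
    rw [Set.union_inter_distrib_right]
    refine (Set.encard_union_le _ _).trans ?_
    push_cast
    exact add_le_add (hn y) (hm y)
  · intro x hx
    obtain ⟨U, hU, hinj⟩ := hp x
    refine ⟨U, mem_nhdsWithin_of_mem_nhds hU, 1, fun y => ?_⟩
    rw [Nat.cast_one, Set.encard_le_one_iff]
    rintro a b ⟨ha, ha'⟩ ⟨hb, hb'⟩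
    exact hinj ha hb (by rw [ha', hb'])

theorem locally_injective (G : Type*) [TopologicalSpace G] [TopGroupoid G] [IsEtale G] :
    (∀ x : G, ∃ U ∈ nhds x, Set.InjOn (rng : G → G) U) ∧
    (∀ x : G, ∃ U ∈ nhds x, Set.InjOn (src : G → G) U) := by
  constructor
  · intro x
    obtain ⟨φ, hx, hφ⟩ := IsEtale.rng_localHomeo x
    refine ⟨φ.source, φ.open_source.mem_nhds hx, fun a ha b hb h => φ.injOn ha hb ?_⟩
    rw [← hφ]; exact Subtype.ext h
  · intro x
    obtain ⟨φ, hx, hφ⟩ := IsEtale.src_localHomeo x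
    refine ⟨φ.source, φ.open_source.mem_nhds hx, fun a ha b hb h => φ.injOn ha hb ?_⟩
    rw [← hφ]; exact Subtype.ext h

theorem sec_not_mem {f : E → ℂ} {g : G} (h : g ∉ T.pi '' tsupport f) : f (T.sec g) = 0 := by
  by_contra hne
  exact h ⟨T.sec g, subset_tsupport f hne, T.pi_sec g⟩

theorem exists_conv_finset [IsEtale G] (f : T.Cc) {u : units G} (e : T.fib u) :
    {g : {g : G // rng g = rng (T.pi e.1)} | g.1 ∈ T.pi '' tsupport f.1}.Finite := by
  have hK : IsCompact (T.pi '' tsupport f.1) := f.1.hasCompactSupport.isCompact.image T.pi_continuous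
  obtain ⟨n, hn⟩ := exists_encard_le (locally_injective G).1 hK
  have h := Set.finite_of_encard_le_coe (hn (rng (T.pi e.1)))
  refine Set.Finite.of_finite_image (f := Subtype.val) (h.subset ?_) Subtype.val_injective.injOn
  rintro _ ⟨g, hg, rfl⟩
  exact ⟨hg, g.2⟩

theorem nsq_conv_le [IsEtale G] (f : T.Cc) : ∃ C : NNReal, ∀ (u : units G) (ξ : T.fib u → ℂ),
    (∀ (z : Circle) (e : T.fib u), ξ (T.actFib z e) = z * ξ e) →
    T.nsq (T.conv f.1 ξ) ≤ C * T.nsq ξ := by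
  classical
  set K := T.pi '' tsupport f.1 with hKdef
  have hK : IsCompact K := f.1.hasCompactSupport.isCompact.image T.pi_continuous
  obtain ⟨m, hm⟩ := exists_encard_le (locally_injective G).1 hK
  obtain ⟨n, hn⟩ := exists_encard_le (locally_injective G).2 hK
  obtain ⟨M, hM⟩ := f.1.hasCompactSupport.exists_bound_of_continuous f.1.continuous
  refine ⟨m * Real.toNNReal (M ^ 2) * n, fun u ξ hξ => ?_⟩
  let k : {g : G // src g = u.1} → ℝ≥0∞ := fun y => ‖ξ (T.secFib u y)‖ₑ ^ 2
  let F : {g : G // src g = u.1} × G → ℝ≥0∞ := fun p =>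
    if p.2 ∈ K ∧ src p.2 = rng p.1.1 then k p.1 else 0
  have step1 : ∀ x : {g : G // src g = u.1}, ‖T.conv f.1 ξ (T.secFib u x)‖ₑ ^ 2 ≤
      (m * ENNReal.ofReal (M ^ 2)) *
        ∑' g : {g : G // rng g = rng (T.pi (T.secFib u x).1)},
          if g.1 ∈ K then ‖ξ (T.translate (T.secFib u x) g)‖ₑ ^ 2 else 0 := by
    intro x
    set e := T.secFib u x
    have hfin := T.exists_conv_finset f e
    have hcard : (hfin.toFinset.card : ℝ) ≤ m := by
      have h1 : (Subtype.val '' {g : {g : G // rng g = rng (T.pi e.1)} | g.1 ∈ K}).encard ≤ m := by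
        refine (Set.encard_le_encard ?_).trans (hm (rng (T.pi e.1)))
        rintro _ ⟨g, hg, rfl⟩
        exact ⟨hg, g.2⟩
      rw [Subtype.val_injective.encard_image, hfin.encard_eq_coe_toFinset_card] at h1
      exact_mod_cast h1
    have hsum : T.conv f.1 ξ e = ∑ g ∈ hfin.toFinset, f.1 (T.sec g.1) * ξ (T.translate e g) := by
      rw [conv]
      refine tsum_eq_sum fun g hg => ?_
      rw [T.sec_not_mem (f := f.1) (by simpa using hg), zero_mul]
    have hreal : ‖T.conv f.1 ξ e‖ ^ 2 ≤
        m * M ^ 2 * ∑ g ∈ hfin.toFinset, ‖ξ (T.translate e g)‖ ^ 2 := by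
      calc ‖T.conv f.1 ξ e‖ ^ 2
          ≤ (∑ g ∈ hfin.toFinset, M * ‖ξ (T.translate e g)‖) ^ 2 := by
            rw [hsum]
            gcongr
            refine (norm_sum_le _ _).trans (Finset.sum_le_sum fun g _ => ?_)
            rw [norm_mul]
            gcongr
            exact hM _
        _ ≤ hfin.toFinset.card * ∑ g ∈ hfin.toFinset, (M * ‖ξ (T.translate e g)‖) ^ 2 :=
            sq_sum_le_card_mul_sum_sq
        _ ≤ m * ∑ g ∈ hfin.toFinset, (M * ‖ξ (T.translate e g)‖) ^ 2 := by gcongr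
        _ = _ := by simp only [mul_pow, ← Finset.mul_sum]; ring
    have hE : ∀ z : ℂ, ‖z‖ₑ ^ 2 = ENNReal.ofReal (‖z‖ ^ 2) := fun z => by
      rw [ENNReal.ofReal_pow (norm_nonneg _), ofReal_norm]
    rw [hE]
    refine (ENNReal.ofReal_le_ofReal hreal).trans ?_
    rw [ENNReal.ofReal_mul (by positivity), ENNReal.ofReal_mul (by positivity),
      ENNReal.ofReal_natCast, ENNReal.ofReal_sum_of_nonneg (fun _ _ => by positivity)]
    gcongr
    refine le_trans (le_of_eq ?_) (ENNReal.sum_le_tsum hfin.toFinset)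
    refine Finset.sum_congr rfl fun g hg => ?_
    have hg' : g.1 ∈ K := hfin.mem_toFinset.1 hg
    rw [if_pos hg', hE]
  have step2 : ∑' x : {g : G // src g = u.1},
      ∑' g : {g : G // rng g = rng (T.pi (T.secFib u x).1)},
        (if g.1 ∈ K then ‖ξ (T.translate (T.secFib u x) g)‖ₑ ^ 2 else 0) ≤ ∑' p, F p := by
    rw [← ENNReal.tsum_sigma' (fun p : Σ x : {g : G // src g = u.1},
      {g : G // rng g = rng (T.pi (T.secFib u x).1)} =>
        if p.2.1 ∈ K then ‖ξ (T.translate (T.secFib u p.1) p.2)‖ₑ ^ 2 else 0)]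
    let ψ : (Σ x : {g : G // src g = u.1}, {g : G // rng g = rng (T.pi (T.secFib u x).1)}) →
        {g : G // src g = u.1} × G := fun p =>
      (⟨T.pi (T.translate (T.secFib u p.1) p.2).1, (T.translate (T.secFib u p.1) p.2).2⟩, p.2.1)
    have hψ : ∀ p, (ψ p).1.1 = mul (inv p.2.1) p.1.1 := by
      rintro ⟨x, g⟩
      change T.pi (mul (inv (T.sec g.1)) (T.sec x.1)) = _
      rw [T.pi_hom.map_mul (a := inv (T.sec g.1)) (b := T.sec x.1) (T.src_sec_inv g.2),
        T.pi_hom.map_inv, T.pi_sec, T.pi_sec]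
    have hrng : ∀ p : (Σ x : {g : G // src g = u.1},
        {g : G // rng g = rng (T.pi (T.secFib u x).1)}), rng p.2.1 = rng p.1.1 := by
      rintro ⟨x, g⟩
      have := g.2
      change rng g.1 = rng (T.pi (T.sec x.1)) at this
      rwa [T.pi_sec] at this
    have hinj : Function.Injective ψ := by
      rintro ⟨x, g⟩ ⟨y, h⟩ hp
      have h1 : g.1 = h.1 := congrArg Prod.snd hp
      have h2 : mul (inv g.1) x.1 = mul (inv g.1) y.1 := by
        have := congrArg (fun p => p.1.1) hp
        simp only [hψ] at this
        rw [this, h1]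
      have h3 : x = y := by
        apply Subtype.ext
        refine mul_left_cancel ?_ ?_ h2
        · rw [src_inv]; exact hrng ⟨x, g⟩
        · rw [src_inv, h1]; exact hrng ⟨y, h⟩
      subst h3
      have : g = h := Subtype.ext h1
      rw [this]
    refine le_trans (le_of_eq ?_) (ENNReal.tsum_comp_le_tsum_of_injective hinj F)
    congr 1; funext p
    have hc : src (ψ p).2 = rng (ψ p).1.1 := by
      rw [hψ, rng_mul, rng_inv]
      rw [src_inv]; exact hrng p
    have hk : k (ψ p).1 = ‖ξ (T.translate (T.secFib u p.1) p.2)‖ₑ ^ 2 := by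
      have : ‖ξ (T.secFib u (ψ p).1)‖ = ‖ξ (T.translate (T.secFib u p.1) p.2)‖ :=
        norm_eq_of_pi_eq hξ (T.pi_sec _)
      simp only [k]
      rw [← ofReal_norm, this, ofReal_norm]
    by_cases hp : p.2.1 ∈ K
    · have : (ψ p).2 ∈ K ∧ src (ψ p).2 = rng (ψ p).1.1 := ⟨hp, hc⟩
      simp only [F]
      rw [if_pos hp, if_pos this, hk]
    · have : ¬ ((ψ p).2 ∈ K ∧ src (ψ p).2 = rng (ψ p).1.1) := fun h => hp h.1
      simp only [F]
      rw [if_neg hp, if_neg this]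
  have step3 : ∑' p, F p ≤ n * T.nsq ξ := by
    rw [ENNReal.tsum_prod', nsq, ← ENNReal.tsum_mul_left]
    refine ENNReal.tsum_le_tsum fun y => ?_
    have hfin := Set.finite_of_encard_le_coe (hn (rng y.1))
    have hcard : (hfin.toFinset.card : ℝ≥0∞) ≤ n := by
      have h1 := hn (rng y.1)
      rw [hfin.encard_eq_coe_toFinset_card] at h1
      exact_mod_cast h1
    rw [tsum_eq_sum (s := hfin.toFinset)]
    · refine (Finset.sum_le_card_nsmul _ _ (k y) fun g _ => ?_).trans ?_
      · simp only [F]; split_ifs <;> simp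
      · rw [nsmul_eq_mul]; gcongr
    · intro g hg
      simp only [F]
      rw [if_neg]
      simpa using hg
  calc T.nsq (T.conv f.1 ξ) ≤ ∑' x : {g : G // src g = u.1}, (m * ENNReal.ofReal (M ^ 2)) *
        ∑' g : {g : G // rng g = rng (T.pi (T.secFib u x).1)},
          (if g.1 ∈ K then ‖ξ (T.translate (T.secFib u x) g)‖ₑ ^ 2 else 0) :=
        ENNReal.tsum_le_tsum step1
    _ ≤ (m * ENNReal.ofReal (M ^ 2)) * (n * T.nsq ξ) := by
        rw [ENNReal.tsum_mul_left]
        gcongr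
        exact step2.trans step3
    _ = _ := by
        have : ENNReal.ofReal (M ^ 2) = (Real.toNNReal (M ^ 2) : ℝ≥0∞) := rfl
        rw [this]
        push_cast
        ring

theorem act_injective {z w : Circle} {e : E} (h : T.act z e = T.act w e) : z = w := by
  have h1 := mul_right_cancel (T.src_iota_rng e z) (T.src_iota_rng e w) h
  exact (Prod.mk.inj (T.iota_embedding.injective h1)).2

theorem exists_delta (u : units G) : ∃ (x : E) (δ : T.fib u → ℂ), x ∈ units E ∧ T.pi x = u ∧
    (∀ (z : Circle) (e : T.fib u), δ (T.actFib z e) = z * δ e) ∧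
    (∀ (z : Circle) (e : T.fib u), e.1 = T.act z x → δ e = z) ∧
    (∀ e : T.fib u, T.pi e.1 ≠ u → δ e = 0) := by
  classical
  obtain ⟨x, hx, hxu, -⟩ := T.iota_one_unit u
  let δ : T.fib u → ℂ := fun e => if h : ∃ z, e.1 = T.act z x then (h.choose : ℂ) else 0
  have h1 : ∀ (z : Circle) (e : T.fib u), e.1 = T.act z x → δ e = z := by
    intro z e h
    have hex : ∃ z, e.1 = T.act z x := ⟨z, h⟩
    have : hex.choose = z := T.act_injective (hex.choose_spec.symm.trans h)
    simp only [δ]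
    rw [dif_pos hex, this]
  have h2 : ∀ e : T.fib u, T.pi e.1 ≠ u → δ e = 0 := by
    intro e he
    simp only [δ]
    rw [dif_neg]
    rintro ⟨z, hz⟩
    exact he (by rw [hz, T.pi_act, hxu])
  refine ⟨x, δ, hx, hxu, fun z e => ?_, h1, h2⟩
  by_cases he : T.pi e.1 = u
  · obtain ⟨w, hw⟩ := T.exists_act (hxu.trans he.symm)
    rw [h1 w e hw, h1 (z * w) (T.actFib z e), Circle.coe_mul]
    rw [← T.act_act, ← hw]; rfl
  · rw [h2 e he, h2, mul_zero]
    change T.pi (T.act z e.1) ≠ u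
    rwa [T.pi_act]

end Spaces

end Twist

namespace Twist

section Regular

variable {G E : Type*} [TopologicalSpace G] [TopGroupoid G] [TopologicalSpace E] [TopGroupoid E]
  (T : Twist G E) [IsEtale G]

theorem summable_conv (f : T.Cc) {u : units G} (ξ : T.fib u → ℂ) (e : T.fib u) :
    Summable fun g : {g : G // rng g = rng (T.pi e.1)} =>
      f.1 (T.sec g.1) * ξ (T.translate e g) := by
  refine summable_of_ne_finset_zero (s := (T.exists_conv_finset f e).toFinset) fun g hg => ?_
  rw [T.sec_not_mem (f := f.1) (by simpa using hg), zero_mul]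

theorem conv_mem (f : T.Cc) {u : units G} (ξ : T.L2 u) : T.conv f.1 ξ.1 ∈ T.l2Sub u := by
  refine ⟨T.conv_equivariant ξ.2.1, T.summable_of_nsq ?_⟩
  obtain ⟨C, hC⟩ := T.nsq_conv_le f
  refine ne_top_of_le_ne_top ?_ (hC u ξ.1 ξ.2.1)
  rw [T.nsq_eq]
  exact ENNReal.mul_ne_top ENNReal.coe_ne_top ENNReal.ofReal_ne_top

/-- Convolution by `f` on `ℓ²(G_u; E_u)`, as a linear map. -/
def thetaLin (u : units G) (f : T.Cc) : T.L2 u →ₗ[ℂ] T.L2 u where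
  toFun ξ := ⟨T.conv f.1 ξ.1, T.conv_mem f ξ⟩
  map_add' ξ η := by
    apply Subtype.ext; funext e
    change T.conv f.1 (ξ.1 + η.1) e = T.conv f.1 ξ.1 e + T.conv f.1 η.1 e
    rw [conv, conv, conv, ← (T.summable_conv f _ e).tsum_add (T.summable_conv f _ e)]
    congr 1; funext g; simp only [Pi.add_apply]; ring
  map_smul' c ξ := by
    apply Subtype.ext; funext e
    change T.conv f.1 (c • ξ.1) e = c * T.conv f.1 ξ.1 e
    rw [conv, conv, ← tsum_mul_left]
    congr 1; funext g; simp only [Pi.smul_apply, smul_eq_mul]; ring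

theorem exists_theta_bound (f : T.Cc) :
    ∃ C : ℝ, 0 ≤ C ∧ ∀ (u : units G) (ξ : T.L2 u), ‖T.thetaLin u f ξ‖ ≤ C * ‖ξ‖ := by
  obtain ⟨C, hC⟩ := T.nsq_conv_le f
  refine ⟨Real.sqrt C, Real.sqrt_nonneg _, fun u ξ => ?_⟩
  refine T.norm_le_of_nsq_le (Real.sqrt_nonneg _) ?_
  have hs : Real.sqrt (C : ℝ) ^ 2 = C := Real.sq_sqrt C.2
  rw [hs, ENNReal.ofReal_coe_nnreal]
  exact hC u ξ.1 ξ.2.1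

/-- The representation `θ_u(f) ξ = f * ξ` of `C_c(G;E)` by bounded operators on `ℓ²(G_u; E_u)`. -/
def theta (u : units G) (f : T.Cc) : T.L2 u →L[ℂ] T.L2 u :=
  (T.thetaLin u f).mkContinuousOfExistsBound
    ((T.exists_theta_bound f).imp fun _ hC ξ => hC.2 u ξ)

theorem theta_apply (u : units G) (f : T.Cc) (ξ : T.L2 u) :
    (T.theta u f ξ).1 = T.conv f.1 ξ.1 := rfl

theorem theta_add (u : units G) (f g : T.Cc) :
    T.theta u (f + g) = T.theta u f + T.theta u g := by
  ext ξ : 1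
  apply Subtype.ext; funext e
  change T.conv (f.1 + g.1 : C_c(E, ℂ)) ξ.1 e = T.conv f.1 ξ.1 e + T.conv g.1 ξ.1 e
  rw [conv, conv, conv, ← (T.summable_conv f _ e).tsum_add (T.summable_conv g _ e)]
  congr 1; funext x
  simp only [CompactlySupportedContinuousMap.coe_add, Pi.add_apply]; ring

theorem theta_smul (u : units G) (c : ℂ) (f : T.Cc) : T.theta u (c • f) = c • T.theta u f := by
  ext ξ : 1
  apply Subtype.ext; funext e
  change T.conv (c • f.1 : C_c(E, ℂ)) ξ.1 e = c * T.conv f.1 ξ.1 e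
  rw [conv, conv, ← tsum_mul_left]
  congr 1; funext x
  simp only [CompactlySupportedContinuousMap.coe_smul, Pi.smul_apply, smul_eq_mul]; ring

/-! ## The reduced norm and the reduced twisted groupoid C*-algebra -/

/-- The reduced norm `‖f‖_r = sup_u ‖θ_u(f)‖`. -/
def redNorm (f : T.Cc) : ℝ := ⨆ u : units G, ‖T.theta u f‖

theorem bddAbove_theta (f : T.Cc) : BddAbove (Set.range fun u : units G => ‖T.theta u f‖) := by
  obtain ⟨C, hC, h⟩ := T.exists_theta_bound f
  refine ⟨C, ?_⟩
  rintro _ ⟨u, rfl⟩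
  exact (T.theta u f).opNorm_le_bound hC (h u)

theorem norm_theta_le (u : units G) (f : T.Cc) : ‖T.theta u f‖ ≤ T.redNorm f :=
  le_ciSup (T.bddAbove_theta f) u

theorem redNorm_nonneg (f : T.Cc) : 0 ≤ T.redNorm f :=
  Real.iSup_nonneg fun _ => norm_nonneg _

theorem redNorm_smul (c : ℂ) (f : T.Cc) : T.redNorm (c • f) = ‖c‖ * T.redNorm f := by
  simp only [redNorm, theta_smul, norm_smul]
  exact (Real.mul_iSup_of_nonneg (norm_nonneg c) _).symm

theorem redNorm_add_le (f g : T.Cc) : T.redNorm (f + g) ≤ T.redNorm f + T.redNorm g := by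
  refine Real.iSup_le (fun u => ?_) (add_nonneg (T.redNorm_nonneg f) (T.redNorm_nonneg g))
  rw [theta_add]
  exact (norm_add_le _ _).trans (add_le_add (T.norm_theta_le u f) (T.norm_theta_le u g))

theorem norm_apply_le_redNorm (f : T.Cc) (e : E) : ‖f.1 e‖ ≤ T.redNorm f := by
  let u : units G := ⟨src (T.pi e), src_mem_units _⟩
  let e' : T.fib u := ⟨e, rfl⟩
  obtain ⟨x, δ, hx, hxu, hδ, hδ1, hδ0⟩ := T.exists_delta u
  let gu : {g : G // src g = u.1} := ⟨u.1, src_of_unit u.2⟩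
  have hzero : ∀ g : {g : G // src g = u.1}, g ≠ gu → ‖δ (T.secFib u g)‖ ^ 2 = 0 := by
    intro g hg
    rw [hδ0, norm_zero, zero_pow two_ne_zero]
    intro h
    apply hg
    apply Subtype.ext
    exact (T.pi_sec g.1).symm.trans h
  have hone : ‖δ (T.secFib u gu)‖ ^ 2 = 1 := by
    obtain ⟨z, hz⟩ := T.exists_act (a := x) (b := (T.secFib u gu).1)
      (hxu.trans (T.pi_sec u.1).symm)
    rw [hδ1 z _ hz, Circle.norm_coe, one_pow]
  have hsum := hasSum_single gu hzero
  let δ' : T.L2 u := ⟨δ, hδ, hsum.summable⟩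
  have hnorm : ‖δ'‖ = 1 := by
    have h := L2.norm_sq T u δ'
    rw [hsum.tsum_eq, hone] at h
    nlinarith [norm_nonneg δ']
  have hconv : T.conv f.1 δ e' = f.1 e := by
    rw [conv, tsum_eq_single ⟨T.pi e, rfl⟩]
    · obtain ⟨z, hz⟩ := T.exists_act (a := T.sec (T.pi e)) (b := e) (T.pi_sec _)
      have hsx : src (T.sec (T.pi e)) = x := by
        rw [← src_of_unit hx, T.src_eq_iff, T.pi_sec, hxu]
        exact (src_of_unit u.2).symm
      rw [hδ1 z]
      · conv_rhs => rw [hz, f.2, mul_comm]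
      · change mul (inv (T.sec (T.pi e))) e = T.act z x
        conv_lhs => rw [hz, T.pi_act, T.pi_sec]
        rw [T.mul_act (src_inv _), inv_mul_self, hsx]
    · intro g hg
      rw [hδ0, mul_zero]
      intro h
      apply hg
      apply Subtype.ext
      have hs := T.src_sec_inv g.2
      have h1 : mul (inv g.1) (T.pi e) = src (T.pi e) := by
        refine Eq.trans ?_ h
        change _ = T.pi (mul (inv (T.sec g.1)) e)
        rw [T.pi_hom.map_mul hs, T.pi_hom.map_inv, T.pi_sec]
      have h2 := mul_inv_cancel_left (a := g.1) (b := T.pi e) g.2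
      rw [h1] at h2
      have h3 : src g.1 = src (T.pi e) := by
        have h4 := rng_mul (inv g.1) (T.pi e) ((src_inv _).trans g.2)
        rw [h1, rng_src, rng_inv] at h4
        exact h4.symm
      rw [← h3, mul_src_self] at h2
      exact h2
  have h1 : ‖f.1 e‖ ^ 2 ≤ ‖T.theta u f δ'‖ ^ 2 := by
    rw [L2.norm_sq]
    have h2 := (T.theta u f δ').2.2.le_tsum ⟨T.pi e, rfl⟩ (fun _ _ => by positivity)
    refine le_trans (le_of_eq ?_) h2
    congr 1
    rw [← hconv]
    exact norm_eq_of_pi_eq (a := e') (b := T.secFib u ⟨T.pi e, rfl⟩) (T.theta u f δ').2.1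
      (T.pi_sec _).symm
  have h2 : ‖f.1 e‖ ≤ ‖T.theta u f δ'‖ := le_of_sq_le_sq h1 (norm_nonneg _)
  calc ‖f.1 e‖ ≤ ‖T.theta u f δ'‖ := h2
    _ ≤ ‖T.theta u f‖ * ‖δ'‖ := (T.theta u f).le_opNorm _
    _ ≤ T.redNorm f := by rw [hnorm, mul_one]; exact T.norm_theta_le u f

/-- `C_c(G;E)` with the reduced norm. -/
instance : NormedAddCommGroup T.Cc :=
  AddGroupNorm.toNormedAddCommGroup
    { toFun := T.redNorm
      map_zero' := by
        have := T.redNorm_smul 0 0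
        simpa using this
      add_le' := T.redNorm_add_le
      neg' := fun f => by
        have := T.redNorm_smul (-1 : ℂ) f
        have h : (-1 : ℂ) • f = -f := by
          apply Subtype.ext; ext e
          change (-1 : ℂ) * f.1 e = -f.1 e
          ring
        rwa [h, norm_neg, norm_one, one_mul] at this
      eq_zero_of_map_eq_zero' := fun f hf => by
        apply Subtype.ext
        ext e
        have h := T.norm_apply_le_redNorm f e
        rw [hf] at h
        simpa using h }

theorem norm_def (f : T.Cc) : ‖f‖ = ⨆ u : units G, ‖T.theta u f‖ := rfl

instance : NormedSpace ℂ T.Cc where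
  norm_smul_le c f := (T.redNorm_smul c f).le

/-- The reduced twisted groupoid C*-algebra `C*_r(G;E)`, the completion of `C_c(G;E)` in the
reduced norm, with its Banach space structure. -/
abbrev CStarRed : Type _ := UniformSpace.Completion T.Cc

/-- The canonical inclusion of `C_c(G;E)` in `C*_r(G;E)`. -/
abbrev toCStarRed : T.Cc →L[ℂ] T.CStarRed := UniformSpace.Completion.toComplL

/-- The inclusion of `C_c(G;E)` in `C₀(G;E)`. -/
def ccToC0 (f : T.Cc) : T.C0 :=
  ⟨⟨f.1.toContinuousMap, f.1.hasCompactSupport.is_zero_at_infty⟩, f.2⟩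

theorem norm_ccToC0_le (f : T.Cc) : ‖T.ccToC0 f‖ ≤ ‖f‖ := by
  change ‖(T.ccToC0 f).1‖ ≤ T.redNorm f
  rw [← ZeroAtInftyContinuousMap.norm_toBCF_eq_norm]
  exact (BoundedContinuousFunction.norm_le (T.redNorm_nonneg f)).2 (T.norm_apply_le_redNorm f)

/-- The inclusion of `C_c(G;E)` in `C₀(G;E)`, as a continuous linear map for the reduced norm. -/
def ccToC0L : T.Cc →L[ℂ] T.C0 :=
  LinearMap.mkContinuous ⟨⟨T.ccToC0, fun _ _ => rfl⟩, fun _ _ => rfl⟩ 1 fun f => by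
    rw [one_mul]; exact T.norm_ccToC0_le f

/-- The map `j : C*_r(G;E) → C₀(G;E)`, the continuous linear extension of the inclusion of
`C_c(G;E)` in `C₀(G;E)`. -/
def j : T.CStarRed →L[ℂ] T.C0 := ContinuousLinearMap.extend (F := T.C0) T.ccToC0L T.toCStarRed

theorem j_toCStarRed (f : T.Cc) (e : E) : (T.j (T.toCStarRed f)).1 e = f.1 e := by
  have h : T.j (T.toCStarRed f) = T.ccToC0L f :=
    ContinuousLinearMap.extend_eq _ UniformSpace.Completion.denseRange_coe
      (UniformSpace.Completion.isUniformInducing_coe _) f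
  rw [h]; rfl

end Regular

end Twist

/-! ## The inclusion of the algebra of an open subgroupoid -/

namespace Twist

section Inclusion

variable {G E : Type*} [TopologicalSpace G] [TopGroupoid G] [TopologicalSpace E] [TopGroupoid E]
  (T : Twist G E) (S : OpenSubgroupoid G)

theorem coe_restrict_act (z : Circle) (e : (T.preimage S).carrier) :
    ((T.restrict S).act z e).1 = T.act z e.1 := by
  rw [act, OpenSubgroupoid.coe_mul]
  · rfl
  · exact T.src_iota_rng e.1 z

/-- Extension by zero of a function on `E_S` to a function on `E`. -/
def extendFun (f : (T.preimage S).carrier → ℂ) : E → ℂ := Function.extend Subtype.val f (0 : E → ℂ)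

theorem extendFun_coe (f : (T.preimage S).carrier → ℂ) (e : (T.preimage S).carrier) :
    T.extendFun S f e.1 = f e := Subtype.val_injective.extend_apply f (0 : E → ℂ) e

theorem extendFun_of_notMem (f : (T.preimage S).carrier → ℂ) {e : E}
    (he : T.pi e ∉ S.carrier) : T.extendFun S f e = 0 := by
  refine Function.extend_apply' f (0 : E → ℂ) e ?_
  rintro ⟨a, rfl⟩
  exact he a.2

theorem extendFun_act {f : (T.preimage S).carrier → ℂ}
    (hf : ∀ z e, f ((T.restrict S).act z e) = z * f e) (z : Circle) (e : E) :
    T.extendFun S f (T.act z e) = z * T.extendFun S f e := by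
  by_cases he : T.pi e ∈ S.carrier
  · have h1 := T.coe_restrict_act S z ⟨e, he⟩
    have h2 := T.extendFun_coe S f ⟨e, he⟩
    have h3 := T.extendFun_coe S f ((T.restrict S).act z ⟨e, he⟩)
    rw [h1, hf] at h3
    rw [h3, h2]
  · rw [T.extendFun_of_notMem S f he, T.extendFun_of_notMem S f (by rwa [T.pi_act]), mul_zero]

/-- Extension by zero, as a map from `C_c(S;E_S)` to `C_c(G;E)`. -/
def extendZero [T2Space E] (f : (T.restrict S).Cc) : T.Cc where
  val :=
    { toFun := T.extendFun S f.1
      continuous_toFun :=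
        f.1.hasCompactSupport.continuous_extend_zero (T.preimage S).isOpen f.1.continuous
      hasCompactSupport' := f.1.hasCompactSupport.extend_zero continuous_subtype_val }
  property := T.extendFun_act S f.2

/-- Extension by zero, as a linear map. -/
def extendZeroLin [T2Space E] : (T.restrict S).Cc →ₗ[ℂ] T.Cc where
  toFun := T.extendZero S
  map_add' f g := by
    apply Subtype.ext; ext e
    change T.extendFun S (f.1 + g.1 : C_c(_, ℂ)) e = T.extendFun S f.1 e + T.extendFun S g.1 e
    by_cases he : T.pi e ∈ S.carrier
    · have h (k : (T.preimage S).carrier → ℂ) := T.extendFun_coe S k ⟨e, he⟩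
      simp only [h, CompactlySupportedContinuousMap.coe_add, Pi.add_apply]
    · simp only [T.extendFun_of_notMem S _ he, add_zero]
  map_smul' c f := by
    apply Subtype.ext; ext e
    change T.extendFun S (c • f.1 : C_c(_, ℂ)) e = c * T.extendFun S f.1 e
    by_cases he : T.pi e ∈ S.carrier
    · have h (k : (T.preimage S).carrier → ℂ) := T.extendFun_coe S k ⟨e, he⟩
      simp only [h, CompactlySupportedContinuousMap.coe_smul, Pi.smul_apply, smul_eq_mul]
    · simp only [T.extendFun_of_notMem S _ he, mul_zero]

variable {u : units G} (a : T.fib u) (ha : rng (T.pi a.1) ∈ S.carrier)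

/-- The range of `a`, as a unit of `S`. -/
abbrev orbitUnit : units S.carrier :=
  ⟨⟨rng (T.pi a.1), ha⟩, (S.mem_units_iff _).2 (rng_mem_units _)⟩

/-- Right translation by `a` maps the fibre of `E_S` over the range of `a` into `E_u`. -/
def orbitMap (t : (T.restrict S).fib (T.orbitUnit S a ha)) : T.fib u :=
  ⟨mul t.1.1 a.1, by
    have h : src (T.pi t.1.1) = rng (T.pi a.1) := congrArg Subtype.val t.2
    rw [← T.pi_src, src_mul _ _ (T.src_eq_rng_iff.2 h), T.pi_src]; exact a.2⟩

theorem src_orbit (t : (T.restrict S).fib (T.orbitUnit S a ha)) : src t.1.1 = rng a.1 :=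
  T.src_eq_rng_iff.2 (congrArg Subtype.val t.2)

theorem orbitMap_equivariant {ξ : T.fib u → ℂ}
    (hξ : ∀ (z : Circle) (e : T.fib u), ξ (T.actFib z e) = z * ξ e) (z : Circle)
    (t : (T.restrict S).fib (T.orbitUnit S a ha)) :
    ξ (T.orbitMap S a ha ((T.restrict S).actFib z t)) = z * ξ (T.orbitMap S a ha t) := by
  rw [← hξ]
  congr 1
  apply Subtype.ext
  change mul ((T.restrict S).act z t.1).1 a.1 = T.act z (mul t.1.1 a.1)
  rw [T.coe_restrict_act, T.act_mul (T.src_orbit S a ha t)]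

theorem conv_extendFun {f : (T.preimage S).carrier → ℂ}
    (hf : ∀ z e, f ((T.restrict S).act z e) = z * f e) {ξ : T.fib u → ℂ}
    (hξ : ∀ (z : Circle) (e : T.fib u), ξ (T.actFib z e) = z * ξ e)
    (t : (T.restrict S).fib (T.orbitUnit S a ha)) :
    T.conv (T.extendFun S f) ξ (T.orbitMap S a ha t) =
      (T.restrict S).conv f (fun t => ξ (T.orbitMap S a ha t)) t := by
  have hst := T.src_orbit S a ha t
  have hrng : rng (T.pi (T.orbitMap S a ha t).1) = rng (T.pi t.1.1) := by
    change rng (T.pi (mul t.1.1 a.1)) = _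
    rw [← T.pi_rng, rng_mul _ _ hst, T.pi_rng]
  let φ : {g : S.carrier // rng g = rng ((T.restrict S).pi t.1)} →
      {g : G // rng g = rng (T.pi (T.orbitMap S a ha t).1)} := fun g =>
    ⟨g.1.1, (congrArg Subtype.val g.2).trans hrng.symm⟩
  have hφ : Function.Injective φ := fun g h e =>
    Subtype.ext (Subtype.ext (congrArg (fun x => x.1) e))
  rw [conv, conv, ← hφ.tsum_eq]
  · congr 1; funext g
    have hpi : T.pi ((T.restrict S).sec g.1).1 = g.1.1 :=
      congrArg Subtype.val ((T.restrict S).pi_sec g.1)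
    have hs : src (inv ((T.restrict S).sec g.1)).1 = rng t.1.1 :=
      congrArg Subtype.val ((T.restrict S).src_sec_inv g.2)
    have hsb : src (inv ((T.restrict S).sec g.1).1) = rng (T.orbitMap S a ha t).1 := by
      refine hs.trans ?_
      exact (rng_mul _ _ hst).symm
    have hmem : src (T.pi (mul (inv ((T.restrict S).sec g.1).1) (T.orbitMap S a ha t).1)) = u.1 := by
      rw [← T.pi_src, src_mul _ _ hsb, T.pi_src]; exact (T.orbitMap S a ha t).2
    have h1 : T.extendFun S f (T.sec (φ g).1) * ξ (T.translate (T.orbitMap S a ha t) (φ g)) =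
        T.extendFun S f ((T.restrict S).sec g.1).1 * ξ ⟨_, hmem⟩ :=
      term_eq (T.extendFun_act S hf) hξ ((T.pi_sec _).trans hpi.symm)
        (T.src_sec_inv (φ g).2)
    rw [h1, T.extendFun_coe]
    congr 2
    apply Subtype.ext
    change mul (inv ((T.restrict S).sec g.1).1) (mul t.1.1 a.1) =
      mul (mul (inv ((T.restrict S).sec g.1)) t.1 : (T.preimage S).carrier).1 a.1
    rw [OpenSubgroupoid.coe_mul _ hs, mul_assoc _ _ _ hs hst]
    rfl
  · intro g hg
    by_contra hne
    apply hg
    have hgS : g.1 ∉ S.carrier := fun hgS => hne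
      ⟨⟨⟨g.1, hgS⟩, Subtype.ext (g.2.trans hrng)⟩, rfl⟩
    change T.extendFun S f (T.sec g.1) * _ = 0
    rw [T.extendFun_of_notMem S f (by rwa [T.pi_sec]), zero_mul]

theorem conv_extendFun_of_notMem (f : (T.preimage S).carrier → ℂ) (ξ : T.fib u → ℂ) (e : T.fib u)
    (he : rng (T.pi e.1) ∉ S.carrier) : T.conv (T.extendFun S f) ξ e = 0 := by
  rw [conv]
  refine (tsum_congr fun g => ?_).trans tsum_zero
  rw [T.extendFun_of_notMem S f, zero_mul]
  rw [T.pi_sec]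
  intro hg
  apply he
  rw [← g.2]
  exact S.rng_mem hg

/-- The class of `x` in `G_u` for the relation "`y x⁻¹` lies in `S`". -/
def orbit (u : units G) (x : {g : G // src g = u.1}) : Set {g : G // src g = u.1} :=
  {y | mul y.1 (inv x.1) ∈ S.carrier}

/-- The fibre of `S` over the range of `x` is in bijection with the class of `x`. -/
def orbitEquiv (u : units G) (x : {g : G // src g = u.1}) (hx : rng x.1 ∈ S.carrier) :
    {s : S.carrier // src s = ⟨rng x.1, hx⟩} ≃ orbit S u ⁻¹' {orbit S u x} where
  toFun s := ⟨⟨mul s.1.1 x.1, by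
      rw [src_mul _ _ (congrArg Subtype.val s.2)]; exact x.2⟩, by
      have hs : src s.1.1 = rng x.1 := congrArg Subtype.val s.2
      have hsi : rng (inv s.1.1) = src (inv x.1) := by rw [rng_inv, src_inv, hs]
      ext y
      have hyx : src y.1 = src x.1 := y.2.trans x.2.symm
      have hyx' : src y.1 = rng (inv x.1) := by rw [rng_inv, hyx]
      change mul y.1 (inv (mul s.1.1 x.1)) ∈ S.carrier ↔ mul y.1 (inv x.1) ∈ S.carrier
      rw [inv_mul_rev hs, ← mul_assoc _ _ _ hyx' hsi.symm]
      constructor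
      · intro h
        have h2 := S.mul_mem h s.1.2 (by
          rw [src_mul _ _ (by rw [src_mul _ _ hyx', hsi]), src_inv])
        rwa [inv_mul_cancel_right (by rw [src_mul _ _ hyx', src_inv, hs])] at h2
      · intro h
        exact S.mul_mem h (S.inv_mem s.1.2) (by rw [src_mul _ _ hyx', hsi])⟩
  invFun y := ⟨⟨mul y.1.1 (inv x.1), by
      have h : orbit S u y.1 = orbit S u x := y.2
      have hx' : x ∈ orbit S u x := by
        change mul x.1 (inv x.1) ∈ S.carrier
        rw [mul_inv_self]; exact hx
      rw [← h] at hx'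
      have h1 : src x.1 = rng (inv y.1.1) := by rw [rng_inv, x.2, y.1.2]
      have h2 := S.inv_mem hx'
      rwa [inv_mul_rev h1, inv_inv] at h2⟩, Subtype.ext (by
      change src (mul y.1.1 (inv x.1)) = rng x.1
      rw [src_mul, src_inv]
      rw [rng_inv, y.1.2, x.2])⟩
  left_inv s := Subtype.ext (Subtype.ext (mul_inv_cancel_right (congrArg Subtype.val s.2)))
  right_inv y := Subtype.ext (Subtype.ext (inv_mul_cancel_right (y.1.2.trans x.2.symm)))

theorem nsq_conv_extend_le [IsEtale G] [T2Space E] (f : (T.restrict S).Cc) (ξ : T.L2 u) :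
    T.nsq (T.conv (T.extendFun S f.1) ξ.1) ≤ ENNReal.ofReal (‖f‖ ^ 2) * T.nsq ξ.1 := by
  let h : {g : G // src g = u.1} → ℝ≥0∞ := fun x =>
    ‖T.conv (T.extendFun S f.1) ξ.1 (T.secFib u x)‖ₑ ^ 2
  let k : {g : G // src g = u.1} → ℝ≥0∞ := fun x => ‖ξ.1 (T.secFib u x)‖ₑ ^ 2
  have hconv := T.conv_equivariant (f := T.extendFun S f.1) ξ.2.1
  change ∑' x, h x ≤ _ * ∑' x, k x
  rw [← ENNReal.tsum_fiberwise h (orbit S u), ← ENNReal.tsum_fiberwise k (orbit S u),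
    ← ENNReal.tsum_mul_left]
  refine ENNReal.tsum_le_tsum fun c => ?_
  by_cases hc : ∃ x : {g : G // src g = u.1}, rng x.1 ∈ S.carrier ∧ orbit S u x = c
  · obtain ⟨x, hx, rfl⟩ := hc
    have hx' : rng (T.pi (T.secFib u x).1) ∈ S.carrier := by
      change rng (T.pi (T.sec x.1)) ∈ S.carrier
      rwa [T.pi_sec]
    set a := T.secFib u x with ha
    let v := T.orbitUnit S a hx'
    have hv : v.1 = ⟨rng x.1, hx⟩ := Subtype.ext (by
      change rng (T.pi (T.sec x.1)) = _
      rw [T.pi_sec])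
    let φ : {s : S.carrier // src s = v.1} ≃ orbit S u ⁻¹' {orbit S u x} :=
      (Equiv.subtypeEquivRight fun s => by rw [hv]).trans (orbitEquiv S u x hx)
    have hφ : ∀ s, T.pi (T.orbitMap S a hx' ((T.restrict S).secFib v s)).1 =
        T.pi (T.secFib u (φ s).1).1 := by
      intro s
      have h1 : T.pi ((T.restrict S).sec s.1).1 = s.1.1 :=
        congrArg Subtype.val ((T.restrict S).pi_sec s.1)
      change T.pi (mul ((T.restrict S).sec s.1).1 (T.sec x.1)) = T.pi (T.sec (mul s.1.1 x.1))
      rw [T.pi_hom.map_mul (a := ((T.restrict S).sec s.1).1) (b := T.sec x.1)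
        (T.src_orbit S a hx' ((T.restrict S).secFib v s)), h1, T.pi_sec, T.pi_sec]
    let η : (T.restrict S).fib v → ℂ := fun t => ξ.1 (T.orbitMap S a hx' t)
    have hη := T.orbitMap_equivariant S a hx' ξ.2.1
    have hk : ∑' y : orbit S u ⁻¹' {orbit S u x}, k y = (T.restrict S).nsq η := by
      rw [← φ.tsum_eq, nsq]
      congr 1; funext s
      simp only [k, η]
      rw [← ofReal_norm, ← ofReal_norm, norm_eq_of_pi_eq ξ.2.1 (hφ s)]
    have hh : ∑' y : orbit S u ⁻¹' {orbit S u x}, h y =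
        (T.restrict S).nsq ((T.restrict S).conv f.1 η) := by
      rw [← φ.tsum_eq, nsq]
      congr 1; funext s
      simp only [h, η]
      rw [← T.conv_extendFun S a hx' f.2 ξ.2.1, ← ofReal_norm, ← ofReal_norm,
        norm_eq_of_pi_eq hconv (hφ s)]
    rw [hk, hh]
    by_cases htop : (T.restrict S).nsq η = ⊤
    · exfalso
      refine ne_top_of_le_ne_top ?_ (hk.symm.le.trans (ENNReal.tsum_comp_le_tsum_of_injective
        Subtype.val_injective k)) htop
      have := T.nsq_eq ξ
      change ∑' y, k y = _ at this
      rw [this]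
      exact ENNReal.ofReal_ne_top
    · let η' : (T.restrict S).L2 v := ⟨η, hη, (T.restrict S).summable_of_nsq htop⟩
      have h1 : ‖(T.restrict S).theta v f η'‖ ≤ ‖f‖ * ‖η'‖ :=
        ((T.restrict S).theta v f).le_of_opNorm_le ((T.restrict S).norm_theta_le v f) η'
      have h2 := (T.restrict S).nsq_eq ((T.restrict S).theta v f η')
      have h3 := (T.restrict S).nsq_eq η'
      change (T.restrict S).nsq ((T.restrict S).conv f.1 η) = _ at h2
      change (T.restrict S).nsq η = _ at h3
      rw [h2, h3, ← ENNReal.ofReal_mul (by positivity), ← mul_pow]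
      exact ENNReal.ofReal_le_ofReal (by gcongr)
  · refine le_trans (le_of_eq ?_) (zero_le)
    refine ENNReal.tsum_eq_zero.2 fun y => ?_
    simp only [h]
    rw [T.conv_extendFun_of_notMem, enorm_zero, zero_pow two_ne_zero]
    intro hy
    refine hc ⟨y.1, ?_, y.2⟩
    change rng (T.pi (T.sec y.1.1)) ∈ S.carrier at hy
    rwa [T.pi_sec] at hy

variable [IsEtale G] [T2Space E]

theorem norm_extendZero_le (f : (T.restrict S).Cc) : ‖T.extendZero S f‖ ≤ ‖f‖ := by
  refine Real.iSup_le (fun u => ?_) (norm_nonneg f)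
  refine ContinuousLinearMap.opNorm_le_bound _ (norm_nonneg f) fun ξ => ?_
  exact T.norm_le_of_nsq_le (norm_nonneg f) (T.nsq_conv_extend_le S f ξ)

/-- Extension by zero, as a continuous linear map for the reduced norms. -/
def extendZeroL : (T.restrict S).Cc →L[ℂ] T.Cc :=
  LinearMap.mkContinuous (T.extendZeroLin S) 1 fun f => by
    rw [one_mul]; exact T.norm_extendZero_le S f

/-- The inclusion `i : C*_r(S;E_S) → C*_r(G;E)`, the continuous linear extension of extension by
zero from `C_c(S;E_S)` to `C_c(G;E)`. -/
def incl : (T.restrict S).CStarRed →L[ℂ] T.CStarRed :=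
  (T.toCStarRed.comp (T.extendZeroL S)).extend (T.restrict S).toCStarRed

theorem incl_toCStarRed (f : (T.restrict S).Cc) :
    T.incl S ((T.restrict S).toCStarRed f) = T.toCStarRed (T.extendZero S f) :=
  ContinuousLinearMap.extend_eq _ UniformSpace.Completion.denseRange_coe
    (UniformSpace.Completion.isUniformInducing_coe _) f

end Inclusion

end Twist

end TwistedGroupoid

end

open TwistedGroupoid

/-! The inclusion of sets is a closure argument. A function in C_c(S;E_S) extended by zero vanishes
off E_S. For fixed `e` in E the value of j(b) at `e` is continuous in `b`, and C_c(S;E_S) is dense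
in its completion. Hence j(i(c)) vanishes off E_S for every `c` (`j_incl_of_notMem`).

For S closed, the reverse inclusion comes from a bounded map R (`restrictCStar`) in the direction
opposite to i. Restriction to E_S sends C_c(G;E) to C_c(S;E_S). It is contractive for the reduced
norms (`norm_restrictFun_le`): for a unit u of S, extension by zero embeds ℓ²(S_u;E_S) isometrically
in ℓ²(G_u;E_u), and θ_u of the restriction is the compression of θ_u(f) to this subspace. On
C_c(G;E) the composite i∘R multiplies by the indicator function of E_S. By density, j(i(R b)) equals
j(b) on E_S and is zero elsewhere. If j(b) is supported in E_S, then j(i(R b)) = j(b).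

The conclusion b = i(R b) then rests on the injectivity of j (`j_injective`). Each regular
representation extends to the completion, and the coordinates of its value at `b` on a finitely
supported vector are finite sums involving values of j(b) (`regRep_truncate_apply`). Finitely
supported vectors are dense, so j(b) = 0 forces every regular representation to vanish at `b`. The
reduced norm is the supremum of the norms of these representations, so b = 0. -/

noncomputable section

namespace TwistedGroupoid

open TopGroupoid

namespace Twist

/-! ### Density of the finitely supported vectors in ℓ²(G_u;E_u). -/

section Injectivity

variable {G E : Type*} [TopologicalSpace G] [TopGroupoid G] [TopologicalSpace E] [TopGroupoid E]
  (T : Twist G E)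

/-- Restriction along the section, as an isometry from `ℓ²(G_u; E_u)` into `ℓ²(G_u)`. -/
def L2.toLpIsometry (u : units G) :
    T.L2 u →ₗᵢ[ℂ] lp (fun _ : {g : G // src g = u.1} => ℂ) 2 where
  toLinearMap := L2.toLp T u
  norm_map' _ := rfl

open Classical in
/-- The truncation of `ξ` to the part of `E_u` over a finite subset of `G_u`. -/
def truncate {u : units G} (F : Finset {g : G // src g = u.1}) (ξ : T.L2 u) : T.L2 u :=
  ⟨fun e => if (⟨T.pi e.1, e.2⟩ : {g : G // src g = u.1}) ∈ F then ξ.1 e else 0, by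
    refine ⟨fun z e => ?_, ?_⟩
    · have h : (⟨T.pi (T.actFib z e).1, (T.actFib z e).2⟩ : {g : G // src g = u.1}) =
          ⟨T.pi e.1, e.2⟩ := Subtype.ext (T.pi_act z e.1)
      simp only [h, ξ.2.1 z e]
      split_ifs <;> simp
    · refine Summable.of_nonneg_of_le (fun _ => by positivity) (fun g => ?_) ξ.2.2
      dsimp only
      split_ifs <;> simp⟩

open Classical in
theorem truncate_apply {u : units G} (F : Finset {g : G // src g = u.1}) (ξ : T.L2 u)
    (e : T.fib u) : (T.truncate F ξ).1 e =
      if (⟨T.pi e.1, e.2⟩ : {g : G // src g = u.1}) ∈ F then ξ.1 e else 0 := rfl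

/-- In ℓ²(G_u) the truncations of a vector are the finite partial sums of its expansion in the
standard basis, which converge to it. The isometry into ℓ²(G_u) carries this convergence back. -/
theorem tendsto_truncate {u : units G} (ξ : T.L2 u) :
    Filter.Tendsto (fun F => T.truncate F ξ) Filter.atTop (nhds ξ) := by
  classical
  have hlp := lp.hasSum_single (p := 2) (by simp) (L2.toLp T u ξ)
  rw [(L2.toLpIsometry T u).isometry.isEmbedding.tendsto_nhds_iff]
  refine Filter.Tendsto.congr (fun F => ?_) hlp
  ext g
  rw [lp.coeFn_sum, Finset.sum_apply]
  change _ = (T.truncate F ξ).1 (T.secFib u g)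
  have hg : (⟨T.pi (T.secFib u g).1, (T.secFib u g).2⟩ : {g : G // src g = u.1}) = g :=
    Subtype.ext (T.pi_sec _)
  rw [truncate_apply, hg]
  -- In the coordinate `g`, only the basis vector at `g` contributes to the partial sum over `F`.
  by_cases h : g ∈ F
  · rw [if_pos h, Finset.sum_eq_single g]
    · rw [lp.single_apply_self]; rfl
    · intro x _ hx; exact lp.single_apply_ne _ _ _ hx.symm
    · exact fun h' => (h' h).elim
  · rw [if_neg h]
    refine Finset.sum_eq_zero fun x hx => lp.single_apply_ne _ _ _ ?_
    rintro rfl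
    exact h hx

/-! ### Regular representations of the completion and injectivity of j. -/

variable [IsEtale G]

/-- The regular representation of `C_c(G;E)`, with values taken in `ℓ²(G_u)`. -/
def thetaLp (u : units G) :
    T.Cc →L[ℂ] T.L2 u →L[ℂ] lp (fun _ : {g : G // src g = u.1} => ℂ) 2 :=
  LinearMap.mkContinuous
    ⟨⟨fun f => (L2.toLpIsometry T u).toContinuousLinearMap.comp (T.theta u f), fun f g => by
      rw [T.theta_add, ContinuousLinearMap.comp_add]⟩, fun c f => by
      change (L2.toLpIsometry T u).toContinuousLinearMap.comp (T.theta u (c • f)) = _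
      rw [T.theta_smul, ContinuousLinearMap.comp_smul]; rfl⟩ 1 fun f => by
    rw [one_mul]
    exact ((L2.toLpIsometry T u).norm_toContinuousLinearMap_comp).le.trans (T.norm_theta_le u f)

/-- Extension to the completion asks for a complete target, which is why values are taken in
ℓ²(G_u). The passage is composition with an isometry, so no information on norms is lost. -/
theorem norm_thetaLp_apply (u : units G) (f : T.Cc) : ‖T.thetaLp u f‖ = ‖T.theta u f‖ :=
  (L2.toLpIsometry T u).norm_toContinuousLinearMap_comp

/-- The regular representation of `C*_r(G;E)`, with values taken in `ℓ²(G_u)`. -/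
def regRep (u : units G) :
    T.CStarRed →L[ℂ] T.L2 u →L[ℂ] lp (fun _ : {g : G // src g = u.1} => ℂ) 2 :=
  (T.thetaLp u).extend T.toCStarRed

theorem regRep_toCStarRed (u : units G) (f : T.Cc) :
    T.regRep u (T.toCStarRed f) = T.thetaLp u f :=
  ContinuousLinearMap.extend_eq _ UniformSpace.Completion.denseRange_coe
    (UniformSpace.Completion.isUniformInducing_coe _) f

/-- The condition is closed in `b`, and on C_c(G;E) it holds because the reduced norm is a supremum
over the units. -/
theorem norm_regRep_le (u : units G) (b : T.CStarRed) : ‖T.regRep u b‖ ≤ ‖b‖ := by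
  induction b using UniformSpace.Completion.induction_on with
  | hp => exact isClosed_le (T.regRep u).continuous.norm continuous_norm
  | ih f =>
    have h := T.regRep_toCStarRed u f
    change T.regRep u (f : T.CStarRed) = _ at h
    rw [h, norm_thetaLp_apply, UniformSpace.Completion.norm_coe]
    exact T.norm_theta_le u f

/-- Evaluation at a point is continuous for the supremum norm. This reduces identities between
values of j to the dense subspace C_c(G;E). -/
theorem continuous_j_apply (e : E) : Continuous fun b : T.CStarRed => (T.j b).1 e := by
  have h1 : Continuous fun f : C₀(E, ℂ) => f e :=
    (BoundedContinuousFunction.lipschitz_eval_const e).continuous.comp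
      ZeroAtInftyContinuousMap.isometry_toBCF.continuous
  have h2 : Continuous fun x : T.C0 => x.1 := continuous_subtype_val
  exact h1.comp (h2.comp T.j.continuous)

/-- The values of `b` on finitely supported vectors are finite sums of values of `j b`. -/
theorem regRep_truncate_apply {u : units G} (F : Finset {g : G // src g = u.1}) (ξ : T.L2 u)
    (b : T.CStarRed) (y : {g : G // src g = u.1}) :
    ∃ s : Finset {g : G // rng g = rng (T.pi (T.secFib u y).1)},
      T.regRep u b (T.truncate F ξ) y =
        ∑ g ∈ s, (T.j b).1 (T.sec g.1) * (T.truncate F ξ).1 (T.translate (T.secFib u y) g) := by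
  classical
  set e := T.secFib u y with he
  -- The summand at `g` evaluates the vector over the arrow `p g` = g⁻¹π(e), so it vanishes unless
  -- `p g` lies in `F`. Right cancellation recovers g⁻¹ from `p g`, so `p` is injective and only
  -- finitely many `g` remain.
  let p : {g : G // rng g = rng (T.pi e.1)} → {g : G // src g = u.1} := fun g =>
    ⟨T.pi (T.translate e g).1, (T.translate e g).2⟩
  have hp : ∀ g, (p g).1 = mul (inv g.1) (T.pi e.1) := fun g => by
    change T.pi (mul (inv (T.sec g.1)) e.1) = _
    rw [T.pi_hom.map_mul (T.src_sec_inv g.2), T.pi_hom.map_inv, T.pi_sec]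
  have hinj : Function.Injective p := by
    intro g h hgh
    have h1 : mul (inv g.1) (T.pi e.1) = mul (inv h.1) (T.pi e.1) := by
      rw [← hp, ← hp, hgh]
    have h2 := mul_right_cancel (by rw [src_inv, g.2]) (by rw [src_inv, h.2]) h1
    exact Subtype.ext (by rw [← inv_inv g.1, h2, inv_inv])
  -- This index set does not depend on `b`. Both sides are therefore continuous in `b`, and it
  -- suffices to treat elements of C_c(G;E), where the left side is the convolution itself.
  refine ⟨F.preimage p hinj.injOn, ?_⟩
  induction b using UniformSpace.Completion.induction_on with
  | hp =>
    refine isClosed_eq ?_ ?_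
    · have h1 : Continuous fun b => T.regRep u b (T.truncate F ξ) :=
        (ContinuousLinearMap.apply ℂ _ (T.truncate F ξ)).continuous.comp (T.regRep u).continuous
      exact (lp.evalCLM ℂ (fun _ : {g : G // src g = u.1} => ℂ) 2 y).continuous.comp h1
    · exact continuous_finsetSum _ fun g _ => (T.continuous_j_apply _).mul continuous_const
  | ih f =>
    have h := T.regRep_toCStarRed u f
    change T.regRep u (f : T.CStarRed) = _ at h
    rw [h]
    change T.conv f.1 (T.truncate F ξ).1 e = _
    rw [conv, tsum_eq_sum (s := F.preimage p hinj.injOn)]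
    · refine Finset.sum_congr rfl fun g _ => ?_
      rw [← T.j_toCStarRed f]; rfl
    · intro g hg
      rw [Finset.mem_preimage] at hg
      rw [truncate_apply, if_neg hg, mul_zero]

/-- A bounded operator is determined by its values on truncated vectors, which converge to the
original vector. On those, each coordinate is a finite sum whose terms all have a value of j(b) as a
factor. -/
theorem regRep_eq_zero {b : T.CStarRed} (hb : T.j b = 0) (u : units G) : T.regRep u b = 0 := by
  ext1 ξ
  refine tendsto_nhds_unique (((T.regRep u b).continuous.tendsto ξ).comp (T.tendsto_truncate ξ)) ?_
  refine tendsto_const_nhds.congr fun F => ?_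
  ext y
  obtain ⟨s, hs⟩ := T.regRep_truncate_apply F ξ b y
  rw [Function.comp_apply, hs, hb]
  refine (Finset.sum_eq_zero fun g _ => ?_).symm
  change (0 : ℂ) * _ = 0
  rw [zero_mul]

/-- The map `j : C*_r(G;E) → C₀(G;E)` is injective. -/
theorem j_injective : Function.Injective T.j := by
  rw [injective_iff_map_eq_zero]
  intro b hb
  -- On C_c(G;E) the norm is by definition a supremum over the regular representations. These do not
  -- distinguish `f` from `f - b`, since they vanish at `b`, and they are contractive on the
  -- completion.
  have key : ∀ f : T.Cc, ‖f‖ ≤ ‖T.toCStarRed f - b‖ := fun f => by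
    refine Real.iSup_le (fun u => ?_) (norm_nonneg _)
    rw [← norm_thetaLp_apply, ← regRep_toCStarRed, ← sub_zero (T.regRep u _),
      ← T.regRep_eq_zero hb u, ← map_sub]
    exact T.norm_regRep_le u _
  -- By density the estimate holds on the whole completion. Taking `c = b` gives ‖b‖ ≤ 0, without a
  -- formula for the norm of a general element of the completion.
  have h : ∀ c : T.CStarRed, ‖c‖ ≤ ‖c - b‖ := fun c => by
    induction c using UniformSpace.Completion.induction_on with
    | hp => exact isClosed_le continuous_norm (continuous_id.sub continuous_const).norm
    | ih f => rw [UniformSpace.Completion.norm_coe]; exact key f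
  simpa using h b

end Injectivity

/-! ### Extension by zero of vectors from ℓ²(S_u;E_S) to ℓ²(G_u;E_u). -/

section ClosedSubgroupoid

variable {G E : Type*} [TopologicalSpace G] [TopGroupoid G] [TopologicalSpace E] [TopGroupoid E]
  (T : Twist G E) (S : OpenSubgroupoid G)

open Classical in
/-- Extension by zero of a function on the fibre of `E_S` over `u` to the fibre of `E`. -/
def extendFib {u : units S.carrier} (ξ : (T.restrict S).fib u → ℂ)
    (e : T.fib (S.unitsIncl u)) : ℂ :=
  if h : T.pi e.1 ∈ S.carrier then ξ ⟨⟨e.1, h⟩, Subtype.ext e.2⟩ else 0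

variable {u : units S.carrier} {ξ : (T.restrict S).fib u → ℂ}

theorem extendFib_of_mem {e : T.fib (S.unitsIncl u)} (h : T.pi e.1 ∈ S.carrier) :
    T.extendFib S ξ e = ξ ⟨⟨e.1, h⟩, Subtype.ext e.2⟩ := dif_pos h

theorem extendFib_of_notMem {e : T.fib (S.unitsIncl u)} (h : T.pi e.1 ∉ S.carrier) :
    T.extendFib S ξ e = 0 := dif_neg h

theorem extendFib_equivariant
    (hξ : ∀ (z : Circle) e, ξ ((T.restrict S).actFib z e) = z * ξ e) (z : Circle)
    (e : T.fib (S.unitsIncl u)) : T.extendFib S ξ (T.actFib z e) = z * T.extendFib S ξ e := by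
  have hpi : T.pi (T.actFib z e).1 = T.pi e.1 := T.pi_act z e.1
  by_cases h : T.pi e.1 ∈ S.carrier
  · rw [T.extendFib_of_mem S h, T.extendFib_of_mem S (by rwa [hpi]), ← hξ]
    congr 1
    exact Subtype.ext (Subtype.ext (T.coe_restrict_act S z ⟨e.1, h⟩).symm)
  · rw [T.extendFib_of_notMem S h, T.extendFib_of_notMem S (by rwa [hpi]), mul_zero]

/-- The inclusion `S_u → G_u` of fibres of the source map. -/
def fibreIncl (S : OpenSubgroupoid G) (u : units S.carrier) (s : {s : S.carrier // src s = u.1}) :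
    {g : G // src g = (S.unitsIncl u).1} :=
  ⟨s.1.1, congrArg Subtype.val s.2⟩

theorem fibreIncl_injective (S : OpenSubgroupoid G) (u : units S.carrier) :
    Function.Injective (fibreIncl S u) := fun _ _ h =>
  Subtype.ext (Subtype.ext (congrArg (fun x => x.1) h))

/-- The sections chosen for E → G and for E_S → S need not agree. Two lifts of the same arrow differ
by a circle element, which does not affect the modulus of an equivariant function. -/
theorem norm_extendFib_secFib
    (hξ : ∀ (z : Circle) e, ξ ((T.restrict S).actFib z e) = z * ξ e)
    (s : {s : S.carrier // src s = u.1}) :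
    ‖T.extendFib S ξ (T.secFib _ (fibreIncl S u s))‖ = ‖ξ ((T.restrict S).secFib u s)‖ := by
  have hp : T.pi (T.secFib _ (fibreIncl S u s)).1 = s.1.1 := T.pi_sec _
  rw [T.extendFib_of_mem S (by rw [hp]; exact s.1.2)]
  refine norm_eq_of_pi_eq hξ (Subtype.ext ?_)
  have h := (T.restrict S).pi_sec s.1
  exact hp.trans (congrArg Subtype.val h).symm

/-- Arrows of G_u outside S contribute nothing, so the sum over G_u collapses to the sum over S_u.
Extension by zero is thus isometric. -/
theorem nsq_extendFib (hξ : ∀ (z : Circle) e, ξ ((T.restrict S).actFib z e) = z * ξ e) :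
    T.nsq (T.extendFib S ξ) = (T.restrict S).nsq ξ := by
  rw [nsq, nsq, ← (fibreIncl_injective S u).tsum_eq]
  · congr 1; funext s
    rw [← ofReal_norm, T.norm_extendFib_secFib S hξ, ofReal_norm]
  · intro g hg
    by_contra hne
    refine hg ?_
    have hgS : g.1 ∉ S.carrier := fun h => hne ⟨⟨⟨g.1, h⟩, Subtype.ext g.2⟩, rfl⟩
    change ‖T.extendFib S ξ (T.secFib _ g)‖ₑ ^ 2 = 0
    rw [T.extendFib_of_notMem S, enorm_zero, zero_pow two_ne_zero]
    change T.pi (T.sec g.1) ∉ S.carrier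
    rwa [T.pi_sec]

/-- Over `E_S`, convolution with a vector supported in `E_S` only sees the values on `E_S`. -/
theorem conv_extendFib {f : E → ℂ} (hf : ∀ (z : Circle) (e : E), f (T.act z e) = z * f e)
    (hξ : ∀ (z : Circle) e, ξ ((T.restrict S).actFib z e) = z * ξ e) (t : (T.restrict S).fib u) :
    T.conv f (T.extendFib S ξ) ⟨t.1.1, congrArg Subtype.val t.2⟩ =
      (T.restrict S).conv (fun e => f e.1) ξ t := by
  set e : T.fib (S.unitsIncl u) := ⟨t.1.1, congrArg Subtype.val t.2⟩ with he
  have heS : T.pi e.1 ∈ S.carrier := t.1.2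
  let φ : {g : S.carrier // rng g = rng ((T.restrict S).pi t.1)} →
      {g : G // rng g = rng (T.pi e.1)} := fun g => ⟨g.1.1, congrArg Subtype.val g.2⟩
  have hφ : Function.Injective φ := fun g h e =>
    Subtype.ext (Subtype.ext (congrArg (fun x => x.1) e))
  have hpi : ∀ g, T.pi (T.translate e g).1 = mul (inv g.1) (T.pi e.1) := fun g => by
    change T.pi (mul (inv (T.sec g.1)) e.1) = _
    rw [T.pi_hom.map_mul (T.src_sec_inv g.2), T.pi_hom.map_inv, T.pi_sec]
  rw [conv, conv, ← hφ.tsum_eq]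
  · congr 1; funext g
    have hg : T.pi ((T.restrict S).sec g.1).1 = g.1.1 :=
      congrArg Subtype.val ((T.restrict S).pi_sec g.1)
    have hs : src (inv ((T.restrict S).sec g.1).1) = rng t.1.1 :=
      congrArg Subtype.val ((T.restrict S).src_sec_inv g.2)
    have hmem : src (T.pi (mul (inv ((T.restrict S).sec g.1).1) e.1)) = (S.unitsIncl u).1 := by
      rw [← T.pi_src, src_mul _ _ hs, T.pi_src]; exact e.2
    -- The lift given by the section of E → G is replaced by the one given by the section of E_S →
    -- S. By `term_eq` the summand depends only on the arrow of G below.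
    have h1 : f (T.sec (φ g).1) * T.extendFib S ξ (T.translate e (φ g)) =
        f ((T.restrict S).sec g.1).1 * T.extendFib S ξ ⟨_, hmem⟩ :=
      term_eq hf (T.extendFib_equivariant S hξ) ((T.pi_sec _).trans hg.symm)
        (T.src_sec_inv (φ g).2)
    have hS : T.pi (mul (inv ((T.restrict S).sec g.1).1) e.1) ∈ S.carrier := by
      rw [T.pi_hom.map_mul hs, T.pi_hom.map_inv, hg]
      refine S.mul_mem (S.inv_mem g.1.2) heS ?_
      rw [src_inv]; exact (φ g).2
    rw [h1, T.extendFib_of_mem S hS]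
    congr 2
    apply Subtype.ext
    apply Subtype.ext
    exact (OpenSubgroupoid.coe_mul (T.preimage S) (a := inv ((T.restrict S).sec g.1))
      (b := t.1) hs).symm
  · intro g hg
    by_contra hne
    apply hg
    have hgS : g.1 ∉ S.carrier := fun h => hne ⟨⟨⟨g.1, h⟩, Subtype.ext g.2⟩, rfl⟩
    change f (T.sec g.1) * T.extendFib S ξ (T.translate e g) = 0
    rw [T.extendFib_of_notMem S, mul_zero]
    rw [hpi]
    intro h
    apply hgS
    -- The terms with `g` outside S vanish. Otherwise g⁻¹π(e) would lie in S together with π(e), and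
    -- then g = π(e)(g⁻¹π(e))⁻¹ would lie in S.
    have h2 := S.mul_mem heS (S.inv_mem h) (by
      rw [rng_inv, src_mul]; rw [src_inv]; exact g.2)
    rw [inv_mul_rev (by rw [src_inv]; exact g.2), inv_inv,
      mul_inv_cancel_left (a := T.pi e.1) (b := g.1) g.2.symm] at h2
    exact h2

/-! ### Contractive restriction to a closed and open subgroupoid. -/

/-- Restriction of functions to `E_S`, for `S` closed. -/
def restrictFun (hS : IsClosed S.carrier) (f : T.Cc) : (T.restrict S).Cc where
  val :=
    { toFun := fun e => f.1 e.1
      continuous_toFun := f.1.continuous.comp continuous_subtype_val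
      -- This is where closedness of S enters: E_S is then closed in E, and it meets the support of
      -- `f` in a compact set.
      hasCompactSupport' := f.1.hasCompactSupport.comp_isClosedEmbedding
        (hS.preimage T.pi_continuous).isClosedEmbedding_subtypeVal }
  property z e := (congrArg f.1 (T.coe_restrict_act S z e)).trans (f.2 z e.1)

variable [IsEtale G]

/-- At a unit u of S, the operator of the restricted function is θ_u(f) compressed to the vectors
supported in E_S, by `conv_extendFib`. A compression does not increase the norm, and the units of S
are among those of G. -/
theorem norm_restrictFun_le (hS : IsClosed S.carrier) (f : T.Cc) :
    ‖T.restrictFun S hS f‖ ≤ ‖f‖ := by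
  refine Real.iSup_le (fun u => ?_) (norm_nonneg f)
  refine ContinuousLinearMap.opNorm_le_bound _ (norm_nonneg f) fun ξ => ?_
  refine (T.restrict S).norm_le_of_nsq_le (norm_nonneg f) ?_
  have hn := T.nsq_extendFib S ξ.2.1
  have hfin : T.nsq (T.extendFib S ξ.1) ≠ ⊤ := by
    rw [hn, nsq_eq]; exact ENNReal.ofReal_ne_top
  let η : T.L2 (S.unitsIncl u) :=
    ⟨T.extendFib S ξ.1, T.extendFib_equivariant S ξ.2.1, T.summable_of_nsq hfin⟩
  have hle : T.nsq (T.conv f.1 (T.extendFib S ξ.1)) ≤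
      ENNReal.ofReal (‖f‖ ^ 2) * T.nsq (T.extendFib S ξ.1) := by
    have h1 : ‖T.theta _ f η‖ ≤ ‖f‖ * ‖η‖ :=
      (T.theta _ f).le_of_opNorm_le (T.norm_theta_le _ f) η
    have h2 := T.nsq_eq (T.theta _ f η)
    have h3 := T.nsq_eq η
    change T.nsq (T.conv f.1 (T.extendFib S ξ.1)) = _ at h2
    change T.nsq (T.extendFib S ξ.1) = _ at h3
    rw [h2, h3, ← ENNReal.ofReal_mul (by positivity), ← mul_pow]
    exact ENNReal.ofReal_le_ofReal (by gcongr)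
  rw [hn] at hle
  refine le_trans ?_ hle
  rw [nsq, nsq]
  -- The square sum over S_u is part of the square sum over G_u. Dropping the other arrows is the
  -- orthogonal projection in the compression.
  refine le_trans (ENNReal.tsum_le_tsum fun s => ?_)
    (ENNReal.tsum_comp_le_tsum_of_injective (fibreIncl_injective S u) _)
  have hc := T.conv_extendFib S f.2 ξ.2.1 ((T.restrict S).secFib u s)
  change ‖(T.restrict S).conv (fun e => f.1 e.1) ξ.1 _‖ₑ ^ 2 ≤ _
  rw [← hc, ← ofReal_norm, ← ofReal_norm]
  refine le_of_eq ?_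
  congr 2
  -- The two sections again give lifts of the same arrow, at which the equivariant convolution has
  -- equal modulus.
  refine norm_eq_of_pi_eq (T.conv_equivariant (T.extendFib_equivariant S ξ.2.1)) ?_
  have h := (T.restrict S).pi_sec s.1
  exact (congrArg Subtype.val h).trans (T.pi_sec _).symm

/-- Restriction of functions to `E_S`, as a continuous linear map for the reduced norms. -/
def restrictFunL (hS : IsClosed S.carrier) : T.Cc →L[ℂ] (T.restrict S).Cc :=
  LinearMap.mkContinuous ⟨⟨T.restrictFun S hS, fun _ _ => rfl⟩, fun _ _ => rfl⟩ 1 fun f => by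
    rw [one_mul]; exact T.norm_restrictFun_le S hS f

/-- The map `C*_r(G;E) → C*_r(S;E_S)` that extends restriction of functions to `E_S`. -/
def restrictCStar (hS : IsClosed S.carrier) : T.CStarRed →L[ℂ] (T.restrict S).CStarRed :=
  ((T.restrict S).toCStarRed.comp (T.restrictFunL S hS)).extend T.toCStarRed

theorem restrictCStar_toCStarRed (hS : IsClosed S.carrier) (f : T.Cc) :
    T.restrictCStar S hS (T.toCStarRed f) = (T.restrict S).toCStarRed (T.restrictFun S hS f) :=
  ContinuousLinearMap.extend_eq _ UniformSpace.Completion.denseRange_coe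
    (UniformSpace.Completion.isUniformInducing_coe _) f

/-! ### Supports of the functions j(i(c)) and the two inclusions. -/

variable [T2Space E]

/-- For `c` in C_c(S;E_S) this is the definition of extension by zero. Vanishing at a given point is
a closed condition on `c`, so it passes to the completion. -/
theorem j_incl_of_notMem (c : (T.restrict S).CStarRed) {e : E} (he : T.pi e ∉ S.carrier) :
    (T.j (T.incl S c)).1 e = 0 := by
  induction c using UniformSpace.Completion.induction_on with
  | hp => exact isClosed_eq ((T.continuous_j_apply e).comp (T.incl S).continuous) continuous_const
  | ih f =>
    have h := T.incl_toCStarRed S f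
    change T.incl S (f : (T.restrict S).CStarRed) = _ at h
    rw [h, j_toCStarRed]
    exact T.extendFun_of_notMem S f.1 he

/-- Both sides are continuous in `b`. For a function in C_c(G;E), restricting to E_S and then
extending by zero keeps the values on E_S. -/
theorem j_incl_restrictCStar (hS : IsClosed S.carrier) (b : T.CStarRed) {e : E}
    (he : T.pi e ∈ S.carrier) : (T.j (T.incl S (T.restrictCStar S hS b))).1 e = (T.j b).1 e := by
  induction b using UniformSpace.Completion.induction_on with
  | hp =>
    exact isClosed_eq ((T.continuous_j_apply e).comp
      ((T.incl S).continuous.comp (T.restrictCStar S hS).continuous)) (T.continuous_j_apply e)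
  | ih f =>
    change (T.j (T.incl S (T.restrictCStar S hS (T.toCStarRed f)))).1 e =
      (T.j (T.toCStarRed f)).1 e
    rw [restrictCStar_toCStarRed, incl_toCStarRed, j_toCStarRed, j_toCStarRed]
    exact T.extendFun_coe S _ ⟨e, he⟩

theorem range_incl_subset : Set.range (T.incl S) ⊆
    {b : T.CStarRed | Function.support (T.j b).1 ⊆ (T.preimage S).carrier} := by
  rintro _ ⟨c, rfl⟩ e he
  by_contra h
  exact he (T.j_incl_of_notMem S c h)

/-- By injectivity it suffices to compare the images under j pointwise. They agree on E_S in any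
case. Off E_S the left one always vanishes, and the right one does by the support hypothesis. -/
theorem incl_restrictCStar (hS : IsClosed S.carrier) {b : T.CStarRed}
    (hb : Function.support (T.j b).1 ⊆ (T.preimage S).carrier) :
    T.incl S (T.restrictCStar S hS b) = b := by
  apply T.j_injective
  apply Subtype.ext
  ext e
  by_cases he : T.pi e ∈ S.carrier
  · exact T.j_incl_restrictCStar S hS b he
  · rw [T.j_incl_of_notMem S _ he]
    by_contra hne
    exact he (hb (Ne.symm hne))

end ClosedSubgroupoid

end Twist

end TwistedGroupoid

end

theorem proposition3p7 {G E : Type*} [TopologicalSpace G] [TopGroupoid G] [T2Space G]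
    [LocallyCompactSpace G] [IsEtale G] [TopologicalSpace E] [TopGroupoid E] [T2Space E]
    [LocallyCompactSpace E] (T : Twist G E) (S : OpenSubgroupoid G) :
    Set.range (T.incl S) ⊆
        {b : T.CStarRed | Function.support (T.j b).1 ⊆ (T.preimage S).carrier} ∧
      (IsClosed S.carrier →
        Set.range (T.incl S) =
          {b : T.CStarRed | Function.support (T.j b).1 ⊆ (T.preimage S).carrier}) :=
  ⟨T.range_incl_subset S, fun hS => (T.range_incl_subset S).antisymm fun b hb =>
    -- The preimage of `b` under i is the restriction of `b` to S.
    ⟨T.restrictCStar S hS b, T.incl_restrictCStar S hS hb⟩⟩
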